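/- Let $k$ be a field. For a finite hypergraph $H$ with vertex set $V$ and edge set $E\subseteq 2^V$, let $R_H=k[x_v: v\in V]/(\prod_{v\in e}x_v : e\in E)$ be its hypergraph algebra and let $P_{R_H}(t)=\sum_{i\ge 0}\dim_k \mathrm{Tor}_i^{R_H}(k,k)\,t^i$ be its Poincaré series, where $k$ is $R_H$ modulo the ideal generated by the variables (all these dimensions are finite for the algebras below). For $n\ge 0$ let $L_n=k[x_1,\dots,x_{n+1}]/(x_1x_2,x_2x_3,\dots,x_nx_{n+1})$, and for $n\ge 3$ let $C_n=k[x_1,\dots,x_n]/(x_1x_2,x_2x_3,\dots,x_{n-1}x_n,x_nx_1)$. Then $P_{L_0}(t)=1+t$, $P_{L_1}(t)=\dfrac{1+t}{1-t}$, $$P_{L_n}(t)=\frac{(1+t)P_{L_{n-1}}(t)P_{L_{n-2}}(t)}{(1+t)P_{L_{n-2}}(t)-tP_{L_{n-1}}(t)}\qquad(n\ge 2),$$ $$P_{C_n}(t)=\frac{(1+t)P_{L_{n-2}}(t)P_{L_{n-4}}(t)}{(1+t)P_{L_{n-4}}(t)-tP_{L_{n-2}}(t)}\qquad(n\ge 4)$$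 as formal power series (all denominators are invertible). Furthermore, let $\alpha\ge 1$ and $d=2\alpha$. Let $L_n^{d,\alpha}$ ($n\ge 0$) be the hypergraph algebra of any hyperline, that is, a hypergraph with $nd-(n-1)\alpha$ vertices and $n$ edges $e_1,\dots,e_n$ of size $d$ such that, for $i\ne j$, $|e_i\cap e_j|=\alpha$ if $|i-j|=1$ and $e_i\cap e_j=\emptyset$ otherwise. Let $C_n^{d,\alpha}$ ($n\ge 3$) be the hypergraph algebra of any hypercycle, that is, a hypergraph with $n(d-\alpha)$ vertices and $n$ edges $e_1,\dots,e_n$ of size $d$ such that, for $i\ne j$, $|e_i\cap e_j|=\alpha$ if $i-j\equiv\pm1\pmod n$ and $e_i\cap e_j=\emptyset$ otherwise. Then $$P_{L_n^{2\alpha,\alpha}}(t)=(1+t)^{(n+1)(\alpha-1)}P_{L_n}(t)\quad(n\ge 0),\qquad P_{C_n^{2\alpha,\alpha}}(t)=(1+t)^{n(\alpha-1)}P_{C_n}(t)\quad(n\ge 3).$$ -/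

import Mathlib

open CategoryTheory

universe u v

noncomputable section

/-- `Tor_i^R(R/m, R/m)` as a vector space over `k`, for a `k`-algebra `R` and an ideal `m`.
When `m` is the ideal generated by the variables of a graded `k`-algebra `R`, this is
`Tor_i^R(k, k)`. -/
def torResidue (k : Type u) [Field k] (R : Type v) [CommRing R] [Algebra k R]
    (m : Ideal R) (i : ℕ) : ModuleCat.{v} k :=
  (ModuleCat.restrictScalars (algebraMap k R)).obj
    (((Tor (ModuleCat.{v} R) i).obj (ModuleCat.of R (R ⧸ m))).obj (ModuleCat.of R (R ⧸ m)))

/-- The ideal `(∏_{v ∈ e} x_v : e ∈ E)` of `k[x_v : v ∈ V]`. -/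
def edgeIdeal (k : Type u) [Field k] {V : Type v} (E : Set (Finset V)) :
    Ideal (MvPolynomial V k) :=
  Ideal.span ((fun e : Finset V => ∏ w ∈ e, MvPolynomial.X w) '' E)

/-- The hypergraph algebra of the hypergraph `(V, E)`. -/
abbrev HypergraphAlgebra (k : Type u) [Field k] {V : Type v} (E : Set (Finset V)) :
    Type (max u v) :=
  MvPolynomial V k ⧸ edgeIdeal k E

/-- The ideal of the hypergraph algebra generated by the classes of the variables. -/
def irrelevantIdeal (k : Type u) [Field k] {V : Type v} (E : Set (Finset V)) :
    Ideal (HypergraphAlgebra k E) :=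
  Ideal.span (Set.range fun w : V => Ideal.Quotient.mk (edgeIdeal k E) (MvPolynomial.X w))

/-- `Tor_i^R(k, k)` for the hypergraph algebra `R` of `(V, E)`, as a `k`-vector space. -/
def hypergraphTor (k : Type u) [Field k] {V : Type v} (E : Set (Finset V)) (i : ℕ) :
    ModuleCat.{max u v} k :=
  torResidue k (HypergraphAlgebra k E) (irrelevantIdeal k E) i

/-- The Poincaré series `∑_{i ≥ 0} dim_k Tor_i^R(k, k) t^i` of the hypergraph algebra `R`
of `(V, E)`. -/
def poincareSeries (k : Type u) [Field k] {V : Type v} (E : Set (Finset V)) : PowerSeries ℤ :=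
  PowerSeries.mk fun i => (Module.finrank k (hypergraphTor k E i) : ℤ)

/-- The `n` edges `{x_1, x_2}, …, {x_n, x_{n+1}}` of the line graph `L_n`. -/
def lineEdge (n : ℕ) (i : Fin n) : Finset (Fin (n + 1)) := {i.castSucc, i.succ}

/-- The `n` edges `{x_1, x_2}, …, {x_{n-1}, x_n}, {x_n, x_1}` of the cycle graph `C_n`;
`finRotate n` sends `i` to `i + 1` modulo `n`. -/
def cycleEdge (n : ℕ) (i : Fin n) : Finset (Fin n) := {i, finRotate n i}

/-- The family `e` of subsets of `V` is the family of edges of a hyperline with parameters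
`d` and `α`. -/
structure IsHyperline {V : Type v} [Fintype V] [DecidableEq V] (d α : ℕ) {n : ℕ}
    (e : Fin n → Finset V) : Prop where
  card_vertices : (Fintype.card V : ℤ) = n * d - (n - 1) * α
  card_edge : ∀ i, (e i).card = d
  card_inter : ∀ i j : Fin n, |(i : ℤ) - j| = 1 → (e i ∩ e j).card = α
  inter_eq_empty : ∀ i j : Fin n, i ≠ j → |(i : ℤ) - j| ≠ 1 → e i ∩ e j = ∅

/-- `i` and `j` differ by `1` modulo `n`. -/
def CyclicallyAdjacent {n : ℕ} (i j : Fin n) : Prop :=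
  (i : ℤ) - j ≡ 1 [ZMOD n] ∨ (j : ℤ) - i ≡ 1 [ZMOD n]

/-- The family `e` of subsets of `V` is the family of edges of a hypercycle with parameters
`d` and `α`. -/
structure IsHypercycle {V : Type v} [Fintype V] [DecidableEq V] (d α : ℕ) {n : ℕ}
    (e : Fin n → Finset V) : Prop where
  card_vertices : (Fintype.card V : ℤ) = n * ((d : ℤ) - α)
  card_edge : ∀ i, (e i).card = d
  card_inter : ∀ i j : Fin n, i ≠ j → CyclicallyAdjacent i j → (e i ∩ e j).card = α
  inter_eq_empty : ∀ i j : Fin n, i ≠ j → ¬ CyclicallyAdjacent i j → e i ∩ e j = ∅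

/-- The Poincaré series of the graph algebra `L_n`. -/
def lineSeries (k : Type u) [Field k] (n : ℕ) : PowerSeries ℤ :=
  poincareSeries k (Set.range (lineEdge n))

/-- The Poincaré series of the graph algebra `C_n`. -/
def cycleSeries (k : Type u) [Field k] (n : ℕ) : PowerSeries ℤ :=
  poincareSeries k (Set.range (cycleEdge n))

end

/-! Blow up a graph $G$ on `ι`: each vertex $i$ becomes a nonempty block of variables with product
$y_i$, and $y_iy_j=0$ along edges. If $I$ is the independence polynomial of $G$, then
`finite_and_poincareSeries_blockEdges` says $P_R(t)=(1+t)^{|V|-|\iota|}/I(G;u)$ with $u=-t/(1+t)$.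
For $d=2\alpha$ every hyperline (hypercycle) is a blow-up of a path (cycle) with all blocks of size
$\alpha$, and the two recursions express the deletion of a vertex in $I$.

Put $J_T=(y_t:t\in T)$. For $i\notin T$ one has $(J_T:y_i)=J_{T\cup N(i)}$
(`hasColonIdeals_blockMonomial`), so multiplication by $y_i$ gives $0\to R/J_{T\cup N(i)}\to
R/J_T\to R/J_{T\cup\{i\}}\to 0$. The crux, `torMap_colonMap_eq_zero`, is that the first map is zero
on $\mathrm{Tor}(-,k)$. The long exact sequence then breaks up, and the series of $R/J_T$ satisfy
$P_{T\cup\{i\}}=P_T+tP_{T\cup N(i)}$, $P_\emptyset=1$. The solution is $I(G-T;u)/I(G;u)$, so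
$R/J_\iota$ has series $1/I(G;u)$.

To pass from $J_\iota$ to the ideal of all variables, treat one block at a time
(`hasTorSeries_mixedSets`). With the other blocks killed, $y_l$ and the variables of block $l$ are
regular: ceasing to kill $y_l$ divides the series by $1+t$, and killing the variables of the block
multiplies it by $1+t$ once for each. -/

noncomputable section

/-! ### Tor as a functor of its first argument, with natural long exact sequences. -/

section Tor

open MonoidalCategory

universe w

variable {R : Type w} [CommRing R]

/-- The functor `M ↦ M ⊗ P` for a chain complex `P`. -/
def tensorComplex (P : ChainComplex (ModuleCat.{w} R) ℕ) :
    ModuleCat.{w} R ⥤ ChainComplex (ModuleCat.{w} R) ℕ where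
  obj X := (((tensoringLeft (ModuleCat.{w} R)).obj X).mapHomologicalComplex _).obj P
  map f := (NatTrans.mapHomologicalComplex ((tensoringLeft (ModuleCat.{w} R)).map f) _).app P
  map_id X := by ext; simp
  map_comp f g := by ext; simp

lemma tensorComplex_map_f (P : ChainComplex (ModuleCat.{w} R) ℕ) {X Y : ModuleCat.{w} R}
    (f : X ⟶ Y) (n : ℕ) : ((tensorComplex P).map f).f n = f ▷ P.X n := rfl

instance (P : ChainComplex (ModuleCat.{w} R) ℕ) : (tensorComplex P).Additive where
  map_add {X Y f g} := by
    ext n : 1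
    exact MonoidalPreadditive.add_whiskerRight _ _

/-- Flatness of each term of `P` gives exactness degree by degree; the long exact sequences in the
first variable come from this. -/
lemma tensorComplex_shortExact (P : ChainComplex (ModuleCat.{w} R) ℕ)
    (hP : ∀ n, Module.Flat R (P.X n)) {S : ShortComplex (ModuleCat.{w} R)} (hS : S.ShortExact) :
    (S.map (tensorComplex P)).ShortExact := by
  refine HomologicalComplex.shortExact_of_degreewise_shortExact _ fun n => ?_
  have := hP n
  have h := hS.map_of_exact (tensorRight (P.X n))
  exact h

/-- `Tor_n(M, N)`, computed by the chosen projective resolution of `N`. -/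
def torModule (N : ModuleCat.{w} R) (n : ℕ) (M : Type w) [AddCommGroup M] [Module R M] :
    ModuleCat.{w} R :=
  ((tensorComplex (projectiveResolution N).complex).obj (ModuleCat.of R M)).homology n

section Maps

variable (N : ModuleCat.{w} R) (n : ℕ)
  {M M' M'' : Type w} [AddCommGroup M] [Module R M] [AddCommGroup M'] [Module R M']
  [AddCommGroup M''] [Module R M'']

/-- The map `Tor_n(M, N) → Tor_n(M', N)` induced by a linear map `M → M'`. -/
def torMap (f : M →ₗ[R] M') : torModule N n M →ₗ[R] torModule N n M' :=
  (HomologicalComplex.homologyMap ((tensorComplex _).map (ModuleCat.ofHom f)) n).hom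

lemma torMap_id : torMap N n (LinearMap.id : M →ₗ[R] M) = LinearMap.id := by
  have : ModuleCat.ofHom (LinearMap.id : M →ₗ[R] M) = 𝟙 _ := rfl
  rw [torMap, this, CategoryTheory.Functor.map_id, HomologicalComplex.homologyMap_id]
  rfl

lemma torMap_comp (g : M' →ₗ[R] M'') (f : M →ₗ[R] M') :
    torMap N n (g ∘ₗ f) = torMap N n g ∘ₗ torMap N n f := by
  rw [torMap, ModuleCat.ofHom_comp, CategoryTheory.Functor.map_comp,
    HomologicalComplex.homologyMap_comp]
  rfl

lemma torMap_comp_apply (g : M' →ₗ[R] M'') (f : M →ₗ[R] M') (z : torModule N n M) :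
    torMap N n (g ∘ₗ f) z = torMap N n g (torMap N n f z) := by
  rw [torMap_comp]; rfl

lemma torMap_zero : torMap N n (0 : M →ₗ[R] M') = 0 := by
  have : ModuleCat.ofHom (0 : M →ₗ[R] M') = 0 := rfl
  rw [torMap, this, CategoryTheory.Functor.map_zero, HomologicalComplex.homologyMap_zero]
  rfl

/-- The scalar `x` can be moved across the tensor product to the resolution of `N`. There it lifts
the zero map of `N`, hence is null-homotopic. -/
lemma torMap_smul_id_eq_zero (x : R) (hx : ∀ z : N, x • z = 0) :
    torMap N n (x • LinearMap.id : M →ₗ[R] M) = 0 := by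
  set Q := projectiveResolution N
  let μ : Q.complex ⟶ Q.complex := x • 𝟙 Q.complex
  have hμ : μ ≫ Q.π = 0 := by
    apply HomologicalComplex.to_single_hom_ext
    ext z
    have : (μ ≫ Q.π).f 0 = x • Q.π.f 0 := by
      simp [μ]
    rw [this]
    exact hx _
  have h1 : (tensorComplex Q.complex).map (ModuleCat.ofHom (x • LinearMap.id : M →ₗ[R] M)) =
      (((tensoringLeft (ModuleCat.{w} R)).obj (ModuleCat.of R M)).mapHomologicalComplex _).map μ := by
    ext n : 1
    apply ModuleCat.MonoidalCategory.tensor_ext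
    intro a b
    simp only [Functor.map_smul, tensorComplex_map_f, μ]
    exact TensorProduct.smul_tmul' x a b
  have h2 : Homotopy μ 0 := ProjectiveResolution.liftHomotopyZero μ hμ
  have h3 := (((tensoringLeft (ModuleCat.{w} R)).obj (ModuleCat.of R M)).mapHomotopy h2).homologyMap_eq n
  rw [Functor.map_zero, HomologicalComplex.homologyMap_zero] at h3
  rw [torMap, h1]
  exact congrArg ModuleCat.Hom.hom h3

variable {N n}

lemma exact_shortExact {f : M →ₗ[R] M'} {g : M' →ₗ[R] M''} (hf : Function.Injective f)
    (hfg : Function.Exact f g) (hg : Function.Surjective g) :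
    (ShortComplex.mk (ModuleCat.ofHom f) (ModuleCat.ofHom g)
      (by ext x; exact hfg.apply_apply_eq_zero x)).ShortExact where
  exact := (ShortComplex.ShortExact.moduleCat_exact_iff_function_exact _).2 hfg
  mono_f := (ModuleCat.mono_iff_injective _).2 hf
  epi_g := (ModuleCat.epi_iff_surjective _).2 hg

lemma tensorComplex_exact_shortExact (N : ModuleCat.{w} R)
    {f : M →ₗ[R] M'} {g : M' →ₗ[R] M''} (hf : Function.Injective f)
    (hfg : Function.Exact f g) (hg : Function.Surjective g) :
    ((ShortComplex.mk (ModuleCat.ofHom f) (ModuleCat.ofHom g)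
      (by ext x; exact hfg.apply_apply_eq_zero x)).map
        (tensorComplex (projectiveResolution N).complex)).ShortExact :=
  tensorComplex_shortExact _ (fun _ => inferInstance) (exact_shortExact hf hfg hg)

variable (N n)

/-- The connecting map `Tor_{n+1}(M'', N) → Tor_n(M, N)` of a short exact sequence
`0 → M → M' → M'' → 0`. -/
def torδ {f : M →ₗ[R] M'} {g : M' →ₗ[R] M''} (hf : Function.Injective f)
    (hfg : Function.Exact f g) (hg : Function.Surjective g) :
    torModule N (n + 1) M'' →ₗ[R] torModule N n M :=
  ((tensorComplex_exact_shortExact N hf hfg hg).δ (n + 1) n (by simp)).hom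

section Exactness

variable {f : M →ₗ[R] M'} {g : M' →ₗ[R] M''}

lemma torMap_exact (hf : Function.Injective f) (hfg : Function.Exact f g)
    (hg : Function.Surjective g) : Function.Exact (torMap N n f) (torMap N n g) :=
  (ShortComplex.ShortExact.moduleCat_exact_iff_function_exact _).1
    ((tensorComplex_exact_shortExact N hf hfg hg).homology_exact₂ n)

lemma torMap_torδ_exact (hf : Function.Injective f) (hfg : Function.Exact f g)
    (hg : Function.Surjective g) :
    Function.Exact (torMap N (n + 1) g) (torδ N n hf hfg hg) :=
  (ShortComplex.ShortExact.moduleCat_exact_iff_function_exact _).1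
    ((tensorComplex_exact_shortExact N hf hfg hg).homology_exact₃ (n + 1) n (by simp))

lemma torδ_torMap_exact (hf : Function.Injective f) (hfg : Function.Exact f g)
    (hg : Function.Surjective g) : Function.Exact (torδ N n hf hfg hg) (torMap N n f) :=
  (ShortComplex.ShortExact.moduleCat_exact_iff_function_exact _).1
    ((tensorComplex_exact_shortExact N hf hfg hg).homology_exact₁ (n + 1) n (by simp))

lemma torδ_naturality {L L' L'' : Type w} [AddCommGroup L] [Module R L] [AddCommGroup L']
    [Module R L'] [AddCommGroup L''] [Module R L''] {f₁ : L →ₗ[R] L'} {g₁ : L' →ₗ[R] L''}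
    (hf : Function.Injective f) (hfg : Function.Exact f g) (hg : Function.Surjective g)
    (hf₁ : Function.Injective f₁) (hfg₁ : Function.Exact f₁ g₁) (hg₁ : Function.Surjective g₁)
    (a : M →ₗ[R] L) (b : M' →ₗ[R] L') (c : M'' →ₗ[R] L'') (hab : b ∘ₗ f = f₁ ∘ₗ a)
    (hbc : c ∘ₗ g = g₁ ∘ₗ b) (z : torModule N (n + 1) M'') :
    torδ N n hf₁ hfg₁ hg₁ (torMap N (n + 1) c z) = torMap N n a (torδ N n hf hfg hg z) := by
  let φ : ShortComplex.mk (ModuleCat.ofHom f) (ModuleCat.ofHom g)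
      (by ext x; exact hfg.apply_apply_eq_zero x) ⟶
      ShortComplex.mk (ModuleCat.ofHom f₁) (ModuleCat.ofHom g₁)
      (by ext x; exact hfg₁.apply_apply_eq_zero x) :=
    { τ₁ := ModuleCat.ofHom a
      τ₂ := ModuleCat.ofHom b
      τ₃ := ModuleCat.ofHom c
      comm₁₂ := by ext x; exact (LinearMap.congr_fun hab x).symm
      comm₂₃ := by ext x; exact (LinearMap.congr_fun hbc x).symm }
  have h := HomologicalComplex.HomologySequence.δ_naturality
    ((tensorComplex (projectiveResolution N).complex).mapShortComplex.map φ)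
    (tensorComplex_exact_shortExact N hf hfg hg) (tensorComplex_exact_shortExact N hf₁ hfg₁ hg₁)
    (n + 1) n (by simp)
  exact (ConcreteCategory.congr_hom h z).symm

end Exactness

lemma torMap_zero_surjective {g : M' →ₗ[R] M''} (hg : Function.Surjective g) :
    Function.Surjective (torMap N 0 g) := by
  have hS := tensorComplex_exact_shortExact N (LinearMap.ker g).injective_subtype
    (LinearMap.exact_subtype_ker_map g) hg
  have h2 : Epi (HomologicalComplex.homologyMap
      ((tensorComplex (projectiveResolution N).complex).map (ModuleCat.ofHom g)) 0) :=
    have : Epi (((tensorComplex (projectiveResolution N).complex).map (ModuleCat.ofHom g)).f 0) :=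
      ((HomologicalComplex.shortExact_iff_degreewise_shortExact _).1 hS 0).epi_g
    HomologicalComplex.epi_homologyMap_of_epi_of_not_rel _ _ (by simp)
  exact (ModuleCat.epi_iff_surjective _).1 h2

/-- `Tor_n(R, N)` is the homology of the projective resolution of `N`. -/
def torModuleSelfIso : torModule N n R ≅ (projectiveResolution N).complex.homology n :=
  HomologicalComplex.homologyMapIso
    (HomologicalComplex.Hom.isoOfComponents (fun i => λ_ ((projectiveResolution N).complex.X i))
      (fun i j _ => (leftUnitor_naturality ((projectiveResolution N).complex.d i j)).symm)) n

lemma subsingleton_torModule_self_succ : Subsingleton (torModule N (n + 1) R) :=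
  ModuleCat.subsingleton_of_isZero
    (((projectiveResolution N).complex_exactAt_succ n).isZero_homology.of_iso
      (torModuleSelfIso N (n + 1)))

/-- `Tor_0(R, N) ≅ N`. -/
def torModuleSelfZeroIso : torModule N 0 R ≅ N :=
  torModuleSelfIso N 0 ≪≫ asIso (HomologicalComplex.homologyMap (projectiveResolution N).π 0) ≪≫
    HomologicalComplex.singleObjHomologySelfIso _ 0 N

/-- Mathlib's `Tor_n(M, N)` is the homology of `M ⊗ P`. -/
def torIsoTorModule (M : ModuleCat.{w} R) :
    ((Tor (ModuleCat.{w} R) n).obj M).obj N ≅ torModule N n M :=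
  (projectiveResolution N).isoLeftDerivedObj _ n



end Maps

end Tor

/-! ### Colon ideals and the vanishing of multiplication by $y_i$ on Tor. -/

section Koszul

universe w

variable {R : Type w} [CommRing R]

lemma exists_comp_eq_of_ker_le {A B C : Type*} [AddCommGroup A] [AddCommGroup B] [AddCommGroup C]
    [Module R A] [Module R B] [Module R C] (f : A →ₗ[R] B) (hf : Function.Surjective f)
    (g : A →ₗ[R] C) (h : LinearMap.ker f ≤ LinearMap.ker g) : ∃ c : B →ₗ[R] C, c ∘ₗ f = g := by
  refine ⟨(LinearMap.ker f).liftQ g h ∘ₗ (f.quotKerEquivOfSurjective hf).symm.toLinearMap, ?_⟩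
  ext a
  have : (f.quotKerEquivOfSurjective hf).symm (f a) = Submodule.Quotient.mk a :=
    (LinearEquiv.symm_apply_eq _).2 rfl
  simp [this]

section Colon

/-- Multiplication by `x` as a map `R/J' → R/J`, where `J' ⊆ (J : x)`. -/
def colonMap {J' J : Ideal R} (x : R) (h : ∀ r, x * r ∈ J ↔ r ∈ J') : (R ⧸ J') →ₗ[R] (R ⧸ J) :=
  Submodule.mapQ J' J (x • LinearMap.id : R →ₗ[R] R) fun r hr =>
    Submodule.mem_comap.2 ((h r).2 hr)

variable {J' J J'' : Ideal R} {x : R}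

lemma colonMap_comp_mkQ (h : ∀ r, x * r ∈ J ↔ r ∈ J') :
    colonMap x h ∘ₗ J'.mkQ = J.mkQ ∘ₗ (x • LinearMap.id) := rfl

lemma colonMap_injective (h : ∀ r, x * r ∈ J ↔ r ∈ J') : Function.Injective (colonMap x h) := by
  refine (injective_iff_map_eq_zero _).2 fun a ha => ?_
  obtain ⟨r, rfl⟩ := Submodule.mkQ_surjective _ a
  have : J.mkQ (x * r) = 0 := ha
  rw [Submodule.mkQ_apply, Submodule.Quotient.mk_eq_zero] at this ⊢
  exact (h r).1 this

lemma colonMap_exact (h : ∀ r, x * r ∈ J ↔ r ∈ J') (hJ : J ⊔ Ideal.span {x} = J'')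
    (hle : J ≤ J'') : Function.Exact (colonMap x h) (Submodule.factor hle) := by
  intro a
  constructor
  · intro ha
    obtain ⟨r, rfl⟩ := Submodule.mkQ_surjective _ a
    have : J''.mkQ r = 0 := ha
    rw [Submodule.mkQ_apply, Submodule.Quotient.mk_eq_zero, ← hJ] at this
    obtain ⟨a, ha', b, hb, rfl⟩ := Submodule.mem_sup.1 this
    obtain ⟨c, rfl⟩ := Ideal.mem_span_singleton'.1 hb
    refine ⟨J'.mkQ c, ?_⟩
    change J.mkQ (x * c) = _
    have h0 : J.mkQ a = 0 := (Submodule.Quotient.mk_eq_zero J).2 ha'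
    rw [map_add, h0, zero_add, mul_comm]
  · rintro ⟨b, rfl⟩
    obtain ⟨r, rfl⟩ := Submodule.mkQ_surjective _ b
    change J''.mkQ (x * r) = 0
    rw [Submodule.mkQ_apply, Submodule.Quotient.mk_eq_zero, ← hJ]
    exact Ideal.mul_mem_right _ _ (Ideal.mem_sup_right (Ideal.mem_span_singleton_self x))

end Colon

/-- The ideal generated by the `y t` with `t ∈ T`. -/
def genIdeal {ι : Type*} (y : ι → R) (T : Finset ι) : Ideal R := Ideal.span (y '' T)

/-- The ideals generated by subsets of the family `y` have colon ideals of the same form: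
`((y_t : t ∈ T) : y_i) = (y_t : t ∈ T ∪ N_i)` for `i ∉ T`. -/
def HasColonIdeals {ι : Type*} [DecidableEq ι] (y : ι → R) (Nb : ι → Finset ι) : Prop :=
  ∀ (T : Finset ι) (i : ι), i ∉ T → ∀ r, y i * r ∈ genIdeal y T ↔ r ∈ genIdeal y (T ∪ Nb i)

variable {ι : Type*} {y : ι → R}

lemma genIdeal_mono {S T : Finset ι} (h : S ⊆ T) : genIdeal y S ≤ genIdeal y T :=
  Ideal.span_mono (Set.image_mono (Finset.coe_subset.2 h))

variable [DecidableEq ι]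

lemma genIdeal_sup_span (T : Finset ι) (i : ι) :
    genIdeal y T ⊔ Ideal.span {y i} = genIdeal y (insert i T) := by
  rw [genIdeal, genIdeal, Finset.coe_insert, Set.image_insert_eq, Ideal.span_insert, sup_comm]

/-- Addition as a map `(y_t : t ∈ T) × R → (y_t : t ∈ T ∪ {i})`, `(a, r) ↦ a + r y_i`. -/
def insertMap (y : ι → R) (T : Finset ι) (i : ι) :
    (genIdeal y T × R) →ₗ[R] genIdeal y (insert i T) :=
  (Submodule.inclusion (genIdeal_mono (Finset.subset_insert i T))).coprod
    (LinearMap.toSpanSingleton R _ ⟨y i, Ideal.subset_span ⟨i, by simp, rfl⟩⟩)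

lemma insertMap_apply (T : Finset ι) (i : ι) (p : genIdeal y T × R) :
    (insertMap y T i p : R) = p.1 + p.2 * y i := rfl

lemma insertMap_surjective (T : Finset ι) (i : ι) : Function.Surjective (insertMap y T i) := by
  rintro ⟨r, hr⟩
  rw [← genIdeal_sup_span] at hr
  obtain ⟨a, ha, b, hb, rfl⟩ := Submodule.mem_sup.1 hr
  obtain ⟨c, rfl⟩ := Ideal.mem_span_singleton'.1 hb
  exact ⟨(⟨a, ha⟩, c), rfl⟩

variable {Nb : ι → Finset ι}

/-- A relation $a+ry_i=0$ with $a\in J_T$ puts $r$ in $(J_T:y_i)$. This controls every map defined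
on $J_{T\cup\{i\}}$ through the surjection `insertMap`. -/
lemma mem_of_insertMap_eq_zero (hy : HasColonIdeals y Nb) {T : Finset ι} {i : ι} (hi : i ∉ T)
    {p : genIdeal y T × R} (hp : insertMap y T i p = 0) : p.2 ∈ genIdeal y (T ∪ Nb i) := by
  have h := congrArg Subtype.val hp
  rw [insertMap_apply] at h
  refine (hy T i hi _).1 ?_
  rw [mul_comm, ← neg_eq_of_add_eq_zero_right h]
  exact neg_mem p.1.2

/-- The coefficient of `y_i`, giving an exact sequence
`0 → (y_t : t ∈ T) → (y_t : t ∈ T ∪ {i}) → R/(y_t : t ∈ T ∪ N_i) → 0`. -/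
lemma exists_coeffMap (hy : HasColonIdeals y Nb) {T : Finset ι} {i : ι} (hi : i ∉ T) :
    ∃ c : genIdeal y (insert i T) →ₗ[R] R ⧸ genIdeal y (T ∪ Nb i),
      Function.Surjective c ∧
      Function.Exact (Submodule.inclusion (genIdeal_mono (Finset.subset_insert i T))) c := by
  obtain ⟨c, hc⟩ := exists_comp_eq_of_ker_le (insertMap y T i) (insertMap_surjective T i)
    (Submodule.mkQ (genIdeal y (T ∪ Nb i)) ∘ₗ LinearMap.snd R _ _) (by
      intro p hp
      have h2 := mem_of_insertMap_eq_zero hy hi hp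
      rw [LinearMap.mem_ker, LinearMap.comp_apply, LinearMap.snd_apply, Submodule.mkQ_apply,
        Submodule.Quotient.mk_eq_zero]
      exact h2)
  refine ⟨c, fun b => ?_, fun b => ⟨fun hb => ?_, ?_⟩⟩
  · obtain ⟨r, rfl⟩ := Submodule.mkQ_surjective _ b
    exact ⟨insertMap y T i (0, r), LinearMap.congr_fun hc (0, r)⟩
  · obtain ⟨p, rfl⟩ := insertMap_surjective T i b
    have h2 : Submodule.mkQ (genIdeal y (T ∪ Nb i)) p.2 = 0 :=
      (LinearMap.congr_fun hc p).symm.trans hb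
    rw [Submodule.mkQ_apply, Submodule.Quotient.mk_eq_zero, ← hy T i hi] at h2
    refine ⟨p.1 + ⟨_, h2⟩, ?_⟩
    ext
    rw [insertMap_apply, mul_comm p.2]
    rfl
  · rintro ⟨a, rfl⟩
    have h0 : insertMap y T i (a, 0) =
        Submodule.inclusion (genIdeal_mono (Finset.subset_insert i T)) a := by
      ext
      simp [insertMap_apply]
    rw [← h0]
    exact (LinearMap.congr_fun hc (a, 0)).trans (map_zero (Submodule.mkQ _))

variable [Fintype ι]

/-- A linear map `(y_t : t ∈ T) → R/(y)` kills `y_i r` for `r ∈ (y_t : t ∈ T ∪ N_i)`. -/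
lemma apply_smul_eq_zero (hy : HasColonIdeals y Nb) {T : Finset ι} {i : ι} (hi : i ∉ T)
    (c : genIdeal y T →ₗ[R] R ⧸ genIdeal y Finset.univ) (r : R)
    (hr : r ∈ genIdeal y (T ∪ Nb i)) : c ⟨y i * r, (hy T i hi r).2 hr⟩ = 0 := by
  induction hr using Submodule.span_induction with
  | mem r hr =>
    obtain ⟨s, hs, rfl⟩ := hr
    -- For $s\in T$, $c(y_iy_s)=y_i\,c(y_s)$ is zero because the target is killed by $y_i$. For
    -- $s\in N_i$ the product $y_iy_s$ is already zero in $R$, by the colon property with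
    -- $T=\emptyset$.
    by_cases hsT : s ∈ T
    · have hyi : y i ∈ genIdeal y Finset.univ := Ideal.subset_span ⟨i, by simp, rfl⟩
      have : (⟨y i * y s, (hy T i hi _).2 (Ideal.subset_span ⟨s, hs, rfl⟩)⟩ : genIdeal y T) =
          y i • ⟨y s, Ideal.subset_span ⟨s, hsT, rfl⟩⟩ := rfl
      rw [this, map_smul]
      obtain ⟨b, hb⟩ := Submodule.mkQ_surjective _ (c ⟨y s, Ideal.subset_span ⟨s, hsT, rfl⟩⟩)
      rw [← hb, ← map_smul, Submodule.mkQ_apply, Submodule.Quotient.mk_eq_zero]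
      exact Ideal.mul_mem_right _ _ hyi
    · have hs' : s ∈ Nb i := by
        have := hs
        simp only [Finset.coe_union, Set.mem_union, Finset.mem_coe] at this
        tauto
      have : y i * y s ∈ genIdeal y ∅ :=
        (hy ∅ i (by simp) _).2 (Ideal.subset_span ⟨s, by simpa using hs', rfl⟩)
      have h0 : y i * y s = 0 := by simpa [genIdeal] using this
      have : (⟨y i * y s, (hy T i hi _).2 (Ideal.subset_span ⟨s, hs, rfl⟩)⟩ : genIdeal y T) = 0 :=
        Subtype.ext h0
      rw [this, map_zero]
  | zero =>
    have : (⟨y i * 0, (hy T i hi _).2 (zero_mem _)⟩ : genIdeal y T) = 0 := Subtype.ext (mul_zero _)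
    rw [this, map_zero]
  | add a b ha hb h1 h2 =>
    have : (⟨y i * (a + b), (hy T i hi _).2 (add_mem ha hb)⟩ : genIdeal y T) =
      ⟨y i * a, (hy T i hi _).2 ha⟩ + ⟨y i * b, (hy T i hi _).2 hb⟩ := Subtype.ext (mul_add _ _ _)
    rw [this, map_add, h1, h2, add_zero]
  | smul a b hb h1 =>
    have : (⟨y i * (a • b), (hy T i hi _).2 (Submodule.smul_mem _ a hb)⟩ : genIdeal y T) =
      a • ⟨y i * b, (hy T i hi _).2 hb⟩ := Subtype.ext (by simp; ring)
    rw [this, map_smul, h1, smul_zero]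

/-- Send $y_i$ to $0$. This is well defined: the relations only involve elements $y_ir$ of $J_T$
with $r\in J_{T\cup N_i}$, and `apply_smul_eq_zero` says that `c` kills these. -/
lemma exists_extend (hy : HasColonIdeals y Nb) {T : Finset ι} {i : ι} (hi : i ∉ T)
    (c : genIdeal y T →ₗ[R] R ⧸ genIdeal y Finset.univ) :
    ∃ c' : genIdeal y (insert i T) →ₗ[R] R ⧸ genIdeal y Finset.univ,
      c' ∘ₗ Submodule.inclusion (genIdeal_mono (Finset.subset_insert i T)) = c := by
  obtain ⟨c', hc'⟩ := exists_comp_eq_of_ker_le (insertMap y T i) (insertMap_surjective T i)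
    (c ∘ₗ LinearMap.fst R _ _) (by
      intro p hp
      have h2 := mem_of_insertMap_eq_zero hy hi hp
      have h := congrArg Subtype.val (LinearMap.mem_ker.1 hp)
      rw [insertMap_apply] at h
      have : p.1 = - ⟨y i * p.2, (hy T i hi _).2 h2⟩ := by
        ext
        exact (eq_neg_of_add_eq_zero_left h).trans (congrArg Neg.neg (mul_comm _ _))
      rw [LinearMap.mem_ker, LinearMap.comp_apply, LinearMap.fst_apply, this, map_neg,
        apply_smul_eq_zero hy hi c _ h2, neg_zero])
  refine ⟨c', ?_⟩
  ext a
  have := LinearMap.congr_fun hc' (a, 0)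
  have h0 : insertMap y T i (a, 0) =
      Submodule.inclusion (genIdeal_mono (Finset.subset_insert i T)) a := by
    ext
    simp [insertMap_apply]
  rw [LinearMap.comp_apply, h0] at this
  exact this

section TorVanishing

variable (N : ModuleCat.{w} R)

/-- If multiplication by `y_i` vanishes on `Tor_n(-, N)` for all colon ideals, the quotient maps
`R/(y_t : t ∈ T) → R/(y)` are injective on `Tor_n(-, N)`. -/
lemma torMap_factor_injective (hy : HasColonIdeals y Nb) (n : ℕ)
    (hV : ∀ (T : Finset ι) (i : ι) (hi : i ∉ T), torMap N n (colonMap (y i) (hy T i hi)) = 0)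
    (T : Finset ι) : Function.Injective (torMap N n
      (Submodule.factor (genIdeal_mono (y := y) (Finset.subset_univ T)))) := by
  induction h : (Finset.univ \ T).card using Nat.strong_induction_on generalizing T with
  | _ m ih =>
    by_cases hT : T = Finset.univ
    · subst hT
      have : Submodule.factor (genIdeal_mono (y := y) (Finset.subset_univ Finset.univ)) =
          LinearMap.id := by
        ext; rfl
      rw [this, torMap_id]
      exact Function.injective_id
    · obtain ⟨i, hi⟩ : ∃ i, i ∉ T := by
        by_contra! hc
        exact hT (Finset.eq_univ_iff_forall.2 hc)
      have hcomp : Submodule.factor (genIdeal_mono (y := y) (Finset.subset_univ T)) =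
          Submodule.factor (genIdeal_mono (y := y) (Finset.subset_univ (insert i T))) ∘ₗ
          Submodule.factor (genIdeal_mono (y := y) (Finset.subset_insert i T)) := by
        ext; rfl
      rw [hcomp, torMap_comp, LinearMap.coe_comp]
      refine Function.Injective.comp (ih _ ?_ (insert i T) rfl) ?_
      · rw [← h]
        refine Finset.card_lt_card (Finset.ssubset_iff_of_subset ?_ |>.2 ⟨i, by simp [hi], by simp⟩)
        exact Finset.sdiff_subset_sdiff subset_rfl (Finset.subset_insert i T)
      -- The kernel of $R/J_T\to R/J_{T\cup\{i\}}$ on Tor is the image of the colon map, which is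
      -- zero by `hV`.
      · refine (injective_iff_map_eq_zero _).2 fun z hz => ?_
        obtain ⟨w, rfl⟩ := (torMap_exact N n (colonMap_injective (hy T i hi))
          (colonMap_exact (hy T i hi) (genIdeal_sup_span T i) _)
          (Submodule.factor_surjective _) z).1 hz
        rw [hV T i hi, LinearMap.zero_apply]

/-- The linear maps `(y_t : t ∈ T) → R/(y)` are jointly injective on `Tor_n(-, N)`. -/
lemma torMap_jointly_injective (hy : HasColonIdeals y Nb) (n : ℕ)
    (hV : ∀ (T : Finset ι) (i : ι) (hi : i ∉ T), torMap N n (colonMap (y i) (hy T i hi)) = 0)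
    (T : Finset ι) (z : torModule N n (genIdeal y T))
    (hz : ∀ c : genIdeal y T →ₗ[R] R ⧸ genIdeal y Finset.univ, torMap N n c z = 0) : z = 0 := by
  induction T using Finset.induction_on with
  | empty =>
    have : (LinearMap.id : genIdeal y ∅ →ₗ[R] genIdeal y ∅) = 0 := by
      refine LinearMap.ext fun a => Subtype.ext ?_
      have h : (a : R) = 0 := by simpa [genIdeal] using a.2
      exact h
    have h2 := LinearMap.congr_fun (torMap_id N n (M := genIdeal y ∅)) z
    rw [this, torMap_zero] at h2
    exact h2.symm
  | insert i T hi ih =>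
    obtain ⟨c, hc, hex⟩ := exists_coeffMap hy hi
    -- Composing `c` with $R/J_{T\cup N_i}\to R/(y)$ gives one of the test maps, and that quotient
    -- map is injective on Tor; hence `z` comes from $J_T$.
    have h0 : torMap N n c z = 0 := by
      refine (injective_iff_map_eq_zero _).1 (torMap_factor_injective N hy n hV (T ∪ Nb i)) _ ?_
      rw [← torMap_comp_apply]
      exact hz _
    obtain ⟨w, rfl⟩ := (torMap_exact N n (Submodule.inclusion_injective _) hex hc z).1 h0
    have : w = 0 := by
      refine ih w fun d => ?_
      obtain ⟨d', rfl⟩ := exists_extend hy hi d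
      rw [torMap_comp_apply]
      exact hz d'
    rw [this, map_zero]

/-- Dimension shifting replaces the colon map in degree $n+1$ by $y_i:J_{T\cup N_i}\to J_T$ in
degree $n$. Linear maps $J_T\to R/(y)$ detect all of $\mathrm{Tor}_n(J_T,N)$, by the vanishing
already known in degree $n$, and each of them composes with $y_i$ to zero. -/
theorem torMap_colonMap_eq_zero (hy : HasColonIdeals y Nb) (hN : ∀ i, ∀ z : N, y i • z = 0)
    (n : ℕ) (T : Finset ι) (i : ι) (hi : i ∉ T) :
    torMap N n (colonMap (y i) (hy T i hi)) = 0 := by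
  induction n generalizing T i with
  | zero =>
    ext z
    obtain ⟨w, rfl⟩ := torMap_zero_surjective N (Submodule.mkQ_surjective (genIdeal y (T ∪ Nb i))) z
    rw [← torMap_comp_apply, colonMap_comp_mkQ, torMap_comp_apply,
      torMap_smul_id_eq_zero N 0 (y i) (hN i)]
    simp
  | succ n ih =>
    ext z
    -- Since $\mathrm{Tor}_{n+1}(R,N)=0$, the connecting map from $\mathrm{Tor}_{n+1}(R/J_T,N)$ to
    -- $\mathrm{Tor}_n(J_T,N)$ is injective.
    have := subsingleton_torModule_self_succ N n
    have hex (J : Ideal R) : Function.Exact J.subtype J.mkQ := LinearMap.exact_subtype_mkQ J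
    let f : genIdeal y (T ∪ Nb i) →ₗ[R] genIdeal y T :=
      (y i • LinearMap.id : R →ₗ[R] R).restrict fun r hr => (hy T i hi r).2 hr
    have hnat := torδ_naturality N n (Submodule.subtype_injective (genIdeal y (T ∪ Nb i)))
      (hex _) (Submodule.mkQ_surjective _) (Submodule.subtype_injective (genIdeal y T))
      (hex _) (Submodule.mkQ_surjective _) f (y i • LinearMap.id)
      (colonMap (y i) (hy T i hi)) rfl rfl z
    have hf : torMap N n f (torδ N n (Submodule.subtype_injective (genIdeal y (T ∪ Nb i)))
      (hex _) (Submodule.mkQ_surjective _) z) = 0 := by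
      refine torMap_jointly_injective N hy n ih T _ fun c => ?_
      rw [← torMap_comp_apply]
      have : c ∘ₗ f = 0 := by
        ext ⟨r, hr⟩
        exact apply_smul_eq_zero hy hi c r hr
      rw [this, torMap_zero, LinearMap.zero_apply]
    rw [hf] at hnat
    obtain ⟨w, hw⟩ := (torMap_torδ_exact N n _ (hex _) _ _).1 hnat
    rw [← hw, Subsingleton.elim w 0, map_zero, LinearMap.zero_apply]

end TorVanishing

end Koszul

/-! ### Dimensions over $k$ and generating series of Tor. -/

section TorDimension

universe w

variable (k : Type u) [Field k] {R : Type w} [CommRing R] [Algebra k R]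

/-- The `R`-module `A` is of dimension `d` as a vector space over `k`. -/
def HasDim (A : ModuleCat.{w} R) (d : ℤ) : Prop :=
  Module.Finite k ((ModuleCat.restrictScalars (algebraMap k R)).obj A) ∧
    (Module.finrank k ((ModuleCat.restrictScalars (algebraMap k R)).obj A) : ℤ) = d

variable {k}

lemma HasDim.of_iso {A B : ModuleCat.{w} R} (e : A ≅ B) {d : ℤ} (h : HasDim k A d) :
    HasDim k B d := by
  let e' := ((ModuleCat.restrictScalars (algebraMap k R)).mapIso e).toLinearEquiv
  have := h.1
  exact ⟨Module.Finite.equiv e', by rw [← h.2, e'.finrank_eq]⟩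

lemma HasDim.zero_of_subsingleton (A : ModuleCat.{w} R) [Subsingleton A] : HasDim k A 0 := by
  have : Subsingleton ((ModuleCat.restrictScalars (algebraMap k R)).obj A) :=
    inferInstanceAs (Subsingleton A)
  exact ⟨inferInstance, by simp [Module.finrank_zero_of_subsingleton]⟩

section Exact

variable {A B C : ModuleCat.{w} R} {f : A →ₗ[R] B} {g : B →ₗ[R] C}

lemma HasDim.of_injective {d : ℤ} (hf : Function.Injective f) (hB : HasDim k B d) :
    ∃ d', HasDim k A d' := by
  let f' := ((ModuleCat.restrictScalars (algebraMap k R)).map (ModuleCat.ofHom f)).hom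
  have := hB.1
  exact ⟨_, Module.Finite.of_injective f' hf, rfl⟩

lemma HasDim.of_exact {d d' : ℤ} (hf : Function.Injective f) (hfg : Function.Exact f g)
    (hg : Function.Surjective g) (hA : HasDim k A d) (hC : HasDim k C d') :
    HasDim k B (d + d') := by
  let f' := ((ModuleCat.restrictScalars (algebraMap k R)).map (ModuleCat.ofHom f)).hom
  let g' := ((ModuleCat.restrictScalars (algebraMap k R)).map (ModuleCat.ofHom g)).hom
  have hfg' : Function.Exact f' g' := hfg
  have hf' : Function.Injective f' := hf
  have hg' : Function.Surjective g' := hg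
  have h1 := hA.1
  have h2 := hC.1
  have hB : Module.Finite k ((ModuleCat.restrictScalars (algebraMap k R)).obj B) :=
    Module.Finite.of_exact hfg' hg'
  refine ⟨hB, ?_⟩
  have h3 := LinearMap.finrank_range_add_finrank_ker g'
  rw [LinearMap.exact_iff.1 hfg', LinearMap.finrank_range_of_inj hf',
    LinearMap.range_eq_top.2 hg', finrank_top] at h3
  rw [← h3, ← hA.2, ← hC.2]
  push_cast
  ring

lemma HasDim.left_of_exact {d d' : ℤ} (hf : Function.Injective f) (hfg : Function.Exact f g)
    (hg : Function.Surjective g) (hB : HasDim k B d) (hC : HasDim k C d') :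
    HasDim k A (d - d') := by
  obtain ⟨a, ha⟩ := HasDim.of_injective hf hB
  have h := HasDim.of_exact hf hfg hg ha hC
  have : a = d - d' := by rw [← hB.2, ← h.2.symm]; ring
  exact this ▸ ha

end Exact

section ShortExact

variable (N : ModuleCat.{w} R) {M M' M'' : Type w} [AddCommGroup M] [Module R M]
  [AddCommGroup M'] [Module R M'] [AddCommGroup M''] [Module R M''] {f : M →ₗ[R] M'}
  {g : M' →ₗ[R] M''}

lemma torMap_injective_of_torMap_eq_zero (n : ℕ) (hf : Function.Injective f)
    (hfg : Function.Exact f g) (hg : Function.Surjective g) (h : torMap N n f = 0) :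
    Function.Injective (torMap N n g) := by
  refine (injective_iff_map_eq_zero _).2 fun z hz => ?_
  obtain ⟨w, rfl⟩ := (torMap_exact N n hf hfg hg z).1 hz
  rw [h, LinearMap.zero_apply]

lemma torδ_surjective_of_torMap_eq_zero (n : ℕ) (hf : Function.Injective f)
    (hfg : Function.Exact f g) (hg : Function.Surjective g) (h : torMap N n f = 0) :
    Function.Surjective (torδ N n hf hfg hg) := fun z =>
  (torδ_torMap_exact N n hf hfg hg z).1 (by rw [h, LinearMap.zero_apply])

lemma torModule_zero_iso_of_torMap_eq_zero (hf : Function.Injective f)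
    (hfg : Function.Exact f g) (hg : Function.Surjective g) (h : torMap N 0 f = 0) :
    Nonempty (torModule N 0 M' ≅ torModule N 0 M'') :=
  ⟨(LinearEquiv.ofBijective (torMap N 0 g)
    ⟨torMap_injective_of_torMap_eq_zero N 0 hf hfg hg h,
      torMap_zero_surjective N hg⟩).toModuleIso⟩

lemma torModule_iso_of_linearEquiv (n : ℕ) (e : M ≃ₗ[R] M') :
    Nonempty (torModule N n M ≅ torModule N n M') :=
  ⟨(LinearEquiv.ofLinearMap (torMap N n e.toLinearMap) (torMap N n e.symm.toLinearMap)
    (by rw [← torMap_comp, LinearEquiv.comp_symm, torMap_id])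
    (by rw [← torMap_comp, LinearEquiv.symm_comp, torMap_id])).toModuleIso⟩

variable (k) in
/-- The power series `p` is the generating series of the `k`-dimensions of `Tor_n(M, N)`. -/
def HasTorSeries (N : ModuleCat.{w} R) (M : Type w) [AddCommGroup M] [Module R M]
    (p : PowerSeries ℤ) : Prop :=
  ∀ n, HasDim k (torModule N n M) (p.coeff n)

open PowerSeries

/-- A short exact sequence whose first map vanishes on `Tor_n(-, N)` gives an additive relation
between the series. -/
lemma HasTorSeries.of_torMap_eq_zero (hf : Function.Injective f)
    (hfg : Function.Exact f g) (hg : Function.Surjective g) (h : ∀ n, torMap N n f = 0)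
    {p q : PowerSeries ℤ} (hM : HasTorSeries k N M p) (hM' : HasTorSeries k N M' q) :
    HasTorSeries k N M'' (q + X * p) := by
  rintro (_ | n)
  · obtain ⟨e⟩ := torModule_zero_iso_of_torMap_eq_zero N hf hfg hg (h 0)
    simpa using (hM' 0).of_iso e
  · rw [map_add, coeff_succ_X_mul]
    exact HasDim.of_exact (torMap_injective_of_torMap_eq_zero N _ hf hfg hg (h _))
      (torMap_torδ_exact N n hf hfg hg) (torδ_surjective_of_torMap_eq_zero N n hf hfg hg (h n))
      (hM' (n + 1)) (hM n)

end ShortExact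

variable (N : ModuleCat.{w} R)

lemma hasTorSeries_self (hN : HasDim k N 1) : HasTorSeries k N R 1 := by
  rintro (_ | n)
  · simpa using hN.of_iso (torModuleSelfZeroIso N).symm
  · have := subsingleton_torModule_self_succ N n
    simpa [PowerSeries.coeff_one] using HasDim.zero_of_subsingleton (k := k) (torModule N (n + 1) R)

section Regular

open PowerSeries

variable {J J' : Ideal R} {x : R}

lemma colonMap_self_eq_smul (hx : ∀ r, x * r ∈ J ↔ r ∈ J) :
    colonMap x hx = x • LinearMap.id := by
  ext; rfl

/-- Killing an element that is regular on `R/J` and annihilates `N` multiplies the series by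
`1 + X`. -/
lemma HasTorSeries.quotient_sup_span (hxN : ∀ z : N, x • z = 0) (hx : ∀ r, x * r ∈ J ↔ r ∈ J)
    (hJ : J ⊔ Ideal.span {x} = J') {p : PowerSeries ℤ} (h : HasTorSeries k N (R ⧸ J) p) :
    HasTorSeries k N (R ⧸ J') ((1 + X) * p) := by
  have hle : J ≤ J' := hJ ▸ le_sup_left
  rw [add_mul, one_mul]
  refine HasTorSeries.of_torMap_eq_zero N (colonMap_injective hx) (colonMap_exact hx hJ hle)
    (Submodule.factor_surjective hle) (fun n => ?_) h h
  rw [colonMap_self_eq_smul, torMap_smul_id_eq_zero N n x hxN]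

/-- Converse of `HasTorSeries.quotient_sup_span`: the short exact sequences determine the
coefficients of `p` one after another, degree $n+1$ from degree $n$. -/
lemma HasTorSeries.of_quotient_sup_span (hxN : ∀ z : N, x • z = 0)
    (hx : ∀ r, x * r ∈ J ↔ r ∈ J) (hJ : J ⊔ Ideal.span {x} = J') {p : PowerSeries ℤ}
    (h : HasTorSeries k N (R ⧸ J') ((1 + X) * p)) : HasTorSeries k N (R ⧸ J) p := by
  have hle : J ≤ J' := hJ ▸ le_sup_left
  have hz (n : ℕ) : torMap N n (colonMap x hx) = 0 := by
    rw [colonMap_self_eq_smul, torMap_smul_id_eq_zero N n x hxN]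
  have hg := Submodule.factor_surjective hle
  intro n
  induction n with
  | zero =>
    obtain ⟨e⟩ := torModule_zero_iso_of_torMap_eq_zero N (colonMap_injective hx)
      (colonMap_exact hx hJ hle) hg (hz 0)
    simpa [add_mul] using (h 0).of_iso e.symm
  | succ n ih =>
    have h1 := HasDim.left_of_exact
      (torMap_injective_of_torMap_eq_zero N (n + 1) (colonMap_injective hx)
        (colonMap_exact hx hJ hle) hg (hz _))
      (torMap_torδ_exact N n (colonMap_injective hx) (colonMap_exact hx hJ hle) hg)
      (torδ_surjective_of_torMap_eq_zero N n (colonMap_injective hx)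
        (colonMap_exact hx hJ hle) hg (hz n)) (h (n + 1)) ih
    simpa [add_mul, coeff_succ_X_mul] using h1

end Regular

open PowerSeries in
/-- The series of the modules `R/(y_t : t ∈ T)` are determined by the recursion coming from the
colon ideals. -/
theorem hasTorSeries_quotient_genIdeal {ι : Type*} [DecidableEq ι] [Fintype ι] {y : ι → R}
    {Nb : ι → Finset ι} (hy : HasColonIdeals y Nb) (hyN : ∀ i, ∀ z : N, y i • z = 0)
    (hN : HasDim k N 1) (p : Finset ι → PowerSeries ℤ) (h0 : p ∅ = 1)
    (hp : ∀ T i, i ∉ T → p (insert i T) = p T + X * p (T ∪ Nb i)) (T : Finset ι) :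
    HasTorSeries k N (R ⧸ genIdeal y T) (p T) := by
  intro n
  -- The degree is the outer induction: $T\cup N_i$ may be larger than $T\cup\{i\}$, but it only
  -- enters one degree lower.
  induction n generalizing T with
  | zero =>
    induction T using Finset.induction_on with
    | empty =>
      obtain ⟨e⟩ := torModule_iso_of_linearEquiv N 0
        (Submodule.quotEquivOfEqBot (genIdeal y ∅) (by simp [genIdeal])).symm
      rw [h0]
      exact (hasTorSeries_self N hN 0).of_iso e
    | insert i T hi ih =>
      obtain ⟨e⟩ := torModule_zero_iso_of_torMap_eq_zero N (colonMap_injective (hy T i hi))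
        (colonMap_exact (hy T i hi) (genIdeal_sup_span T i)
          (genIdeal_mono (Finset.subset_insert i T)))
        (Submodule.factor_surjective _) (torMap_colonMap_eq_zero N hy hyN 0 T i hi)
      rw [hp T i hi]
      simpa using ih.of_iso e
  | succ n ihn =>
    induction T using Finset.induction_on with
    | empty =>
      obtain ⟨e⟩ := torModule_iso_of_linearEquiv N (n + 1)
        (Submodule.quotEquivOfEqBot (genIdeal y ∅) (by simp [genIdeal])).symm
      rw [h0]
      exact (hasTorSeries_self N hN (n + 1)).of_iso e
    | insert i T hi ih =>
      have hex := colonMap_exact (hy T i hi) (genIdeal_sup_span T i)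
          (genIdeal_mono (Finset.subset_insert i T))
      have hz (m : ℕ) := torMap_colonMap_eq_zero N hy hyN m T i hi
      rw [hp T i hi, map_add, coeff_succ_X_mul]
      exact HasDim.of_exact
        (torMap_injective_of_torMap_eq_zero N (n + 1) (colonMap_injective (hy T i hi)) hex
          (Submodule.factor_surjective _) (hz _))
        (torMap_torδ_exact N n (colonMap_injective (hy T i hi)) hex
          (Submodule.factor_surjective _))
        (torδ_surjective_of_torMap_eq_zero N n (colonMap_injective (hy T i hi)) hex
          (Submodule.factor_surjective _) (hz n)) ih (ihn _)

end TorDimension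

/-! ### Independence polynomials at $u=-X/(1+X)$. -/

section Independence

variable {ι κ A : Type*} [CommRing A]

open Classical in
/-- The independence polynomial of the subgraph of `G` induced on `U`, evaluated at `u`. -/
def indepSum (G : SimpleGraph ι) (u : A) (U : Finset ι) : A :=
  ∑ S ∈ U.powerset, if G.IsIndepSet (S : Set ι) then u ^ S.card else 0

variable (G : SimpleGraph ι) (u : A)

lemma indepSum_empty : indepSum G u ∅ = 1 := by
  simp [indepSum, SimpleGraph.IsIndepSet]

lemma isIndepSet_insert_iff [DecidableEq ι] {i : ι} {S : Finset ι} (hi : i ∉ S) :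
    G.IsIndepSet (insert i S : Finset ι) ↔ (∀ j ∈ S, ¬ G.Adj i j) ∧ G.IsIndepSet (S : Set ι) := by
  rw [SimpleGraph.IsIndepSet, SimpleGraph.IsIndepSet, Finset.coe_insert,
    Set.pairwise_insert_of_notMem (by simpa using hi)]
  simp only [G.adj_comm _ i, Finset.mem_coe, and_self]
  exact and_comm

/-- Independent sets either avoid $i$, or consist of $i$ and an independent set of non-neighbours of
$i$. -/
lemma indepSum_insert [DecidableEq ι] [DecidableRel G.Adj] {i : ι} {U : Finset ι} (hi : i ∉ U) :
    indepSum G u (insert i U) =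
      indepSum G u U + u * indepSum G u (U.filter fun j => ¬ G.Adj i j) := by
  classical
  rw [indepSum, Finset.sum_powerset_insert hi]
  congr 1
  rw [indepSum, Finset.mul_sum, ← Finset.sum_filter_add_sum_filter_not U.powerset
    (fun S => ∀ j ∈ S, ¬ G.Adj i j), Finset.sum_eq_zero (s := U.powerset.filter
    fun S => ¬ ∀ j ∈ S, ¬ G.Adj i j), add_zero]
  · have : U.powerset.filter (fun S => ∀ j ∈ S, ¬ G.Adj i j) =
        (U.filter fun j => ¬ G.Adj i j).powerset := by
      ext S
      simp only [Finset.mem_filter, Finset.mem_powerset, Finset.subset_iff]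
      grind
    rw [this]
    refine Finset.sum_congr rfl fun S hS => ?_
    have hS' : ∀ j ∈ S, j ∈ U ∧ ¬ G.Adj i j := fun j hj => by
      simpa using Finset.mem_powerset.1 hS hj
    have hiS : i ∉ S := fun h => hi (hS' i h).1
    simp only [isIndepSet_insert_iff G hiS, Finset.card_insert_of_notMem hiS]
    have : ∀ j ∈ S, ¬ G.Adj i j := fun j hj => (hS' j hj).2
    split_ifs <;> simp_all [pow_succ']
  · intro S hS
    obtain ⟨hS, h⟩ := Finset.mem_filter.1 hS
    have hiS : i ∉ S := fun h => hi (Finset.mem_powerset.1 hS h)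
    rw [if_neg]
    rw [isIndepSet_insert_iff G hiS]
    exact fun h' => h h'.1

/-- The independence polynomial only depends on the induced subgraph. -/
lemma indepSum_map {G : SimpleGraph ι} {G' : SimpleGraph κ} (u : A) (f : ι ↪ κ)
    (U : Finset ι) (hf : ∀ i ∈ U, ∀ j ∈ U, G'.Adj (f i) (f j) ↔ G.Adj i j) :
    indepSum G' u (U.map f) = indepSum G u U := by
  classical
  induction h : U.card using Nat.strong_induction_on generalizing U with
  | _ n ih =>
    induction U using Finset.induction_on with
    | empty => simp [indepSum_empty]
    | insert i U hi _ =>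
      rw [Finset.card_insert_of_notMem hi] at h
      rw [Finset.map_insert, indepSum_insert _ _ (by simpa using hi), indepSum_insert _ _ hi,
        ih _ (by omega) U (fun a ha b hb => hf a (by simp [ha]) b (by simp [hb])) rfl,
        Finset.filter_map]
      have : U.filter ((fun j => ¬ G'.Adj (f i) j) ∘ f) = U.filter fun j => ¬ G.Adj i j :=
        Finset.filter_congr fun j hj => not_congr (hf i (by simp) j (by simp [hj]))
      rw [this, ih _ (lt_of_le_of_lt (Finset.card_filter_le _ _) (by omega)) _ _ rfl]
      exact fun a ha b hb => hf a (by simp [(Finset.mem_filter.1 ha).1]) b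
        (by simp [(Finset.mem_filter.1 hb).1])

lemma map_indepSum {B : Type*} [CommRing B] (φ : A →+* B) (U : Finset ι) :
    φ (indepSum G u U) = indepSum G (φ u) U := by
  simp only [indepSum, map_sum]
  refine Finset.sum_congr rfl fun S _ => ?_
  split_ifs <;> simp

lemma indepSum_zero (U : Finset ι) : indepSum G (0 : A) U = 1 := by
  classical
  induction U using Finset.induction_on with
  | empty => exact indepSum_empty _ _
  | insert i U hi ih => rw [indepSum_insert _ _ hi, ih, zero_mul, add_zero]

section Series

open PowerSeries

/-- The power series `1 / (1 + X)`. -/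
def invOneAddX : PowerSeries ℤ := invOfUnit (1 + X) 1

lemma one_add_X_mul_invOneAddX : (1 + X) * invOneAddX = 1 :=
  mul_invOfUnit _ _ (by simp)

/-- The weight `-X / (1 + X)`. -/
def indepWeight : PowerSeries ℤ := -X * invOneAddX

lemma indepWeight_mul : (1 + X) * indepWeight = -X := by
  rw [indepWeight, mul_left_comm, one_add_X_mul_invOneAddX, mul_one]

lemma constantCoeff_indepWeight : constantCoeff indepWeight = 0 := by
  simp [indepWeight]

lemma constantCoeff_indepSum (U : Finset ι) :
    constantCoeff (indepSum G indepWeight U) = 1 := by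
  rw [map_indepSum, constantCoeff_indepWeight, indepSum_zero]

/-- The inverse of the independence polynomial at `-X / (1 + X)`. -/
def indepInv (G : SimpleGraph ι) (U : Finset ι) : PowerSeries ℤ :=
  invOfUnit (indepSum G indepWeight U) 1

lemma indepSum_mul_indepInv (U : Finset ι) :
    indepSum G indepWeight U * indepInv G U = 1 :=
  mul_invOfUnit _ _ (by simp [constantCoeff_indepSum])

/-- This is the recursion of the Tor series, and it dictates the weight. In $(T\cup N(i))^c$ the
vertex $i$ is isolated and contributes a factor $1+u$, so the identity reduces to $u+X(1+u)=0$. -/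
lemma indepSum_compl_insert [Fintype ι] [DecidableEq ι] [DecidableRel G.Adj] {T : Finset ι} {i : ι}
    (hi : i ∉ T) :
    indepSum G indepWeight (insert i T)ᶜ = indepSum G indepWeight Tᶜ +
      X * indepSum G indepWeight (T ∪ Finset.univ.filter (G.Adj i))ᶜ := by
  set W := (insert i T)ᶜ with hW
  have h1 : Tᶜ = insert i W := by
    ext j
    by_cases hj : j = i <;> simp [hW, hj, hi]
  have h2 : (T ∪ Finset.univ.filter (G.Adj i))ᶜ = insert i (W.filter fun j => ¬ G.Adj i j) := by
    ext j
    by_cases hj : j = i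
    · subst hj; simp [hi]
    · simp [hW, hj]
  have h3 : i ∉ W := by simp [hW]
  rw [h1, h2, indepSum_insert _ _ h3, indepSum_insert _ _ (by simp [h3]), Finset.filter_filter]
  simp only [and_self]
  linear_combination -indepSum G indepWeight (W.filter fun j => ¬ G.Adj i j) * indepWeight_mul

end Series

end Independence

/-! ### Squarefree monomial ideals and the residue module. -/

section Squarefree

variable (k : Type u) [Field k] {V : Type v}

open MvPolynomial

lemma prod_X_eq_monomial (e : Finset V) :
    ∏ w ∈ e, (X w : MvPolynomial V k) = monomial (∑ w ∈ e, Finsupp.single w 1) 1 := by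
  rw [monomial_sum_one]; rfl

lemma sum_single_le_iff [DecidableEq V] (e : Finset V) (m : V →₀ ℕ) :
    ∑ w ∈ e, Finsupp.single w 1 ≤ m ↔ e ⊆ m.support := by
  have h (v : V) : (∑ w ∈ e, Finsupp.single w 1 : V →₀ ℕ) v = if v ∈ e then 1 else 0 := by
    simp [Finsupp.finsetSum_apply, Finsupp.single_apply]
  constructor
  · intro hle v hv
    have := hle v
    rw [h, if_pos hv] at this
    exact Finsupp.mem_support_iff.2 (by omega)
  · intro hle v
    rw [h]
    split_ifs with hv
    · exact Nat.one_le_iff_ne_zero.2 (Finsupp.mem_support_iff.1 (hle hv))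
    · exact Nat.zero_le _

/-- The generators are squarefree, so divisibility of a monomial by one of them only depends on its
support. Ideal membership thereby becomes a question about finite sets. -/
lemma mem_edgeIdeal_iff {E : Set (Finset V)} {p : MvPolynomial V k} :
    p ∈ edgeIdeal k E ↔ ∀ m ∈ p.support, ∃ e ∈ E, e ⊆ m.support := by
  classical
  have h : (fun e : Finset V => ∏ w ∈ e, (X w : MvPolynomial V k)) '' E =
      (fun s => monomial s (1 : k)) '' ((fun e => ∑ w ∈ e, Finsupp.single w 1) '' E) := by
    rw [Set.image_image]
    exact Set.image_congr fun e _ => prod_X_eq_monomial k e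
  rw [edgeIdeal, h, mem_ideal_span_monomial_image]
  simp only [Set.exists_mem_image, sum_single_le_iff]

/-- Multiplying by $\prod_{w\in c}x_w$ shifts the monomials of `p` injectively and replaces each
support $S$ by $c\cup S$. -/
lemma prod_X_mul_mem_edgeIdeal_iff [DecidableEq V] {E E' : Set (Finset V)} {c : Finset V}
    (h : ∀ S : Finset V, (∃ e ∈ E, e ⊆ c ∪ S) ↔ ∃ e ∈ E', e ⊆ S) (p : MvPolynomial V k) :
    (∏ w ∈ c, X w) * p ∈ edgeIdeal k E ↔ p ∈ edgeIdeal k E' := by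
  rw [mem_edgeIdeal_iff, mem_edgeIdeal_iff, prod_X_eq_monomial]
  have hs (m : V →₀ ℕ) : (∑ w ∈ c, Finsupp.single w 1 + m).support = c ∪ m.support := by
    ext v
    simp [Finsupp.single_apply]
    tauto
  have hc (m : V →₀ ℕ) :
      coeff (∑ w ∈ c, Finsupp.single w 1 + m) (monomial (∑ w ∈ c, Finsupp.single w 1) 1 * p) =
        coeff m p := by
    rw [coeff_monomial_mul, one_mul]
  constructor
  · intro H m hm
    rw [← h, ← hs]
    exact H _ (by rw [mem_support_iff, hc]; exact mem_support_iff.1 hm)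
  · intro H m hm
    rw [mem_support_iff, coeff_monomial_mul'] at hm
    split_ifs at hm with hle
    · obtain ⟨m', rfl⟩ := exists_add_of_le hle
      rw [hs, h]
      exact H _ (by rw [mem_support_iff]; simpa using hm)
    · exact absurd rfl hm

/-- The ideal of the hypergraph algebra of `(V, E)` generated by the monomials
`∏_{v ∈ e} x_v` with `e ∈ D`. -/
def monomialIdeal (E D : Set (Finset V)) : Ideal (HypergraphAlgebra k E) :=
  Ideal.span ((fun e => Ideal.Quotient.mk (edgeIdeal k E) (∏ w ∈ e, X w)) '' D)

variable {k}

lemma mk_mem_monomialIdeal_iff {E D : Set (Finset V)} {p : MvPolynomial V k} :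
    Ideal.Quotient.mk (edgeIdeal k E) p ∈ monomialIdeal k E D ↔ p ∈ edgeIdeal k (D ∪ E) := by
  have : monomialIdeal k E D = (edgeIdeal k D).map (Ideal.Quotient.mk (edgeIdeal k E)) := by
    refine Eq.trans ?_ (Ideal.map_span _ _).symm
    rw [Set.image_image]
    rfl
  rw [this, Ideal.mem_quotient_iff_mem_sup]
  simp only [edgeIdeal, Set.image_union, Ideal.span_union]

lemma mk_prod_mul_mem_monomialIdeal_iff [DecidableEq V] {E D D' : Set (Finset V)} {c : Finset V}
    (h : ∀ S : Finset V, (∃ e ∈ D ∪ E, e ⊆ c ∪ S) ↔ ∃ e ∈ D' ∪ E, e ⊆ S)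
    (r : HypergraphAlgebra k E) :
    Ideal.Quotient.mk (edgeIdeal k E) (∏ w ∈ c, X w) * r ∈ monomialIdeal k E D ↔
      r ∈ monomialIdeal k E D' := by
  obtain ⟨p, rfl⟩ := Ideal.Quotient.mk_surjective r
  rw [← map_mul, mk_mem_monomialIdeal_iff, mk_mem_monomialIdeal_iff,
    prod_X_mul_mem_edgeIdeal_iff k h]

lemma monomialIdeal_sup_span {E D : Set (Finset V)} (c : Finset V) :
    monomialIdeal k E D ⊔ Ideal.span {Ideal.Quotient.mk (edgeIdeal k E) (∏ w ∈ c, X w)} =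
      monomialIdeal k E (insert c D) := by
  rw [monomialIdeal, monomialIdeal, Set.image_insert_eq, Ideal.span_insert, sup_comm]

lemma irrelevantIdeal_eq (E : Set (Finset V)) :
    irrelevantIdeal k E = monomialIdeal k E (Set.range fun v => {v}) := by
  rw [irrelevantIdeal, monomialIdeal, ← Set.range_comp]
  simp [Function.comp_def]

variable (k) in
/-- The residue module `k` of the hypergraph algebra. -/
abbrev residueModule (E : Set (Finset V)) : ModuleCat.{max u v} (HypergraphAlgebra k E) :=
  ModuleCat.of _ (HypergraphAlgebra k E ⧸ irrelevantIdeal k E)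

lemma mk_prod_smul_residueModule (E : Set (Finset V)) {c : Finset V} (hc : c.Nonempty)
    (z : residueModule k E) : Ideal.Quotient.mk (edgeIdeal k E) (∏ w ∈ c, X w) • z = 0 := by
  obtain ⟨r, rfl⟩ := Ideal.Quotient.mk_surjective z
  obtain ⟨w, hw⟩ := hc
  refine Ideal.Quotient.eq_zero_iff_mem.2 (Ideal.mul_mem_right _ _ ?_)
  refine Ideal.mem_of_dvd _ (map_dvd _ (Finset.dvd_prod_of_mem _ hw)) ?_
  exact Ideal.subset_span ⟨w, rfl⟩

/-- The constant coefficient identifies the module with $k$. An empty edge would put $1$ in the edge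
ideal and make the algebra zero. -/
lemma hasDim_residueModule {E : Set (Finset V)} (hE : ∅ ∉ E) :
    HasDim k (residueModule k E) 1 := by
  let W := (ModuleCat.restrictScalars (algebraMap k (HypergraphAlgebra k E))).obj
    (residueModule k E)
  let f : k →ₗ[k] W := LinearMap.toSpanSingleton k W
    (Ideal.Quotient.mk (irrelevantIdeal k E) 1 : HypergraphAlgebra k E ⧸ irrelevantIdeal k E)
  have hf (a : k) : f a = Ideal.Quotient.mk (irrelevantIdeal k E)
      (Ideal.Quotient.mk (edgeIdeal k E) (C a)) := by
    change Ideal.Quotient.mk (irrelevantIdeal k E)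
      ((Ideal.Quotient.mk (edgeIdeal k E) (C a)) * 1) = _
    rw [mul_one]
  have hX (p : MvPolynomial V k) : Ideal.Quotient.mk (irrelevantIdeal k E)
      (Ideal.Quotient.mk (edgeIdeal k E) p) = f (constantCoeff p) := by
    rw [hf]
    refine Ideal.Quotient.eq.2 ?_
    rw [← map_sub, irrelevantIdeal_eq, mk_mem_monomialIdeal_iff, mem_edgeIdeal_iff]
    intro m hm
    have hm0 : m ≠ 0 := by
      rintro rfl
      simp [mem_support_iff, constantCoeff_eq] at hm
    obtain ⟨v, hv⟩ := Finsupp.support_nonempty_iff.2 hm0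
    exact ⟨{v}, Or.inl ⟨v, rfl⟩, by simpa using hv⟩
  have hbij : Function.Bijective f := by
    constructor
    · refine (injective_iff_map_eq_zero f).2 fun a ha => ?_
      by_contra h0
      rw [hf] at ha
      have ha' := Ideal.Quotient.eq_zero_iff_mem.1 ha
      rw [irrelevantIdeal_eq, mk_mem_monomialIdeal_iff, mem_edgeIdeal_iff] at ha'
      obtain ⟨e, he, he'⟩ := ha' 0 (by simpa [mem_support_iff] using h0)
      obtain rfl : e = ∅ := by simpa using he'
      rcases he with ⟨v, hv⟩ | he
      · exact Finset.singleton_ne_empty v hv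
      · exact hE he
    · intro z
      obtain ⟨r, rfl⟩ := Ideal.Quotient.mk_surjective z
      obtain ⟨p, rfl⟩ := Ideal.Quotient.mk_surjective r
      exact ⟨_, (hX p).symm⟩
  let e := LinearEquiv.ofBijective f hbij
  exact ⟨Module.Finite.equiv e, by rw [← e.finrank_eq]; simp⟩

end Squarefree

/-! ### Blow-ups of graphs and their Poincaré series. -/

section Blocks

open PowerSeries

variable {ι : Type*} [DecidableEq ι] {V : Type v} [Fintype V]

/-- The fibre of `b` over `i`. -/
def block (b : V → ι) (i : ι) : Finset V := Finset.univ.filter fun v => b v = i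

/-- The hypergraph obtained from a graph by replacing each vertex `i` by the fibre of `b`. -/
def blockEdges [DecidableEq V] (G : SimpleGraph ι) (b : V → ι) : Set (Finset V) :=
  {e | ∃ i j, G.Adj i j ∧ e = block b i ∪ block b j}

variable {b : V → ι}

@[simp]
lemma mem_block {i : ι} {v : V} : v ∈ block b i ↔ b v = i := by simp [block]

lemma block_nonempty (hb : Function.Surjective b) (i : ι) : (block b i).Nonempty := by
  obtain ⟨v, hv⟩ := hb i
  exact ⟨v, by simpa using hv⟩

/-- The singletons of elements of `S` and the blocks over `T`. -/
def mixedSets (b : V → ι) (S : Finset V) (T : Finset ι) : Set (Finset V) :=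
  (fun v => {v}) '' (S : Set V) ∪ block b '' (T : Set ι)

lemma insert_block_mixedSets (S : Finset V) (T : Finset ι) (l : ι) :
    insert (block b l) (mixedSets b S T) = mixedSets b S (insert l T) := by
  rw [mixedSets, mixedSets, Finset.coe_insert, Set.image_insert_eq, Set.union_insert]

lemma sum_card_block [Fintype ι] (hb : Function.Surjective b) :
    ∑ i, ((block b i).card - 1) = Fintype.card V - Fintype.card ι := by
  have h : ∑ i, (block b i).card = Fintype.card V :=
    (Finset.card_eq_sum_card_fiberwise (f := b) (s := Finset.univ) (t := Finset.univ)
      (by simp)).symm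
  -- Blocks are nonempty, so no truncated subtraction loses anything.
  rw [Finset.sum_tsub_distrib _ fun i _ => (block_nonempty hb i).card_pos, h]
  simp

variable [DecidableEq V]

/-- A subset of the union of a block and `S` that avoids the block lies in `S`. -/
lemma block_subset_of_subset_union {c S : Finset V} {i j : ι} (hc : c ⊆ block b i) (hij : j ≠ i)
    (h : block b j ⊆ c ∪ S) : block b j ⊆ S := by
  intro v hv
  rcases Finset.mem_union.1 (h hv) with h1 | h1
  · exact absurd ((mem_block.1 hv).symm.trans (mem_block.1 (hc h1))) hij
  · exact h1

variable (k : Type u) [Field k] (G : SimpleGraph ι)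

/-- The class of the product of the variables in a block. -/
def blockMonomial (b : V → ι) (i : ι) : HypergraphAlgebra k (blockEdges G b) :=
  Ideal.Quotient.mk _ (∏ w ∈ block b i, MvPolynomial.X w)

lemma genIdeal_blockMonomial (T : Finset ι) :
    genIdeal (blockMonomial k G b) T =
      monomialIdeal k (blockEdges G b) (block b '' (T : Set ι)) := by
  rw [monomialIdeal, Set.image_image]; rfl

/-- Distinct blocks are disjoint. Adjoining block $i$ to a support therefore completes no other
block; it only turns an edge $\{i,t\}$ into the requirement that block $t$ be contained in the
support. -/
lemma hasColonIdeals_blockMonomial [Fintype ι] [DecidableRel G.Adj] :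
    HasColonIdeals (blockMonomial k G b) (fun i => Finset.univ.filter (G.Adj i)) := by
  intro T i hi r
  rw [genIdeal_blockMonomial, genIdeal_blockMonomial]
  refine mk_prod_mul_mem_monomialIdeal_iff (fun S => ⟨?_, ?_⟩) r
  · rintro ⟨e, ⟨t, ht, rfl⟩ | ⟨s, t, hst, rfl⟩, he⟩
    · refine ⟨_, Or.inl ⟨t, by simpa using Or.inl ht, rfl⟩,
        block_subset_of_subset_union subset_rfl ?_ he⟩
      rintro rfl
      exact hi ht
    · have hs := Finset.union_subset_left he
      have ht := Finset.union_subset_right he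
      by_cases hsi : s = i
      · subst hsi
        exact ⟨_, Or.inl ⟨t, by simp [hst], rfl⟩,
          block_subset_of_subset_union subset_rfl hst.ne' ht⟩
      · by_cases hti : t = i
        · subst hti
          exact ⟨_, Or.inl ⟨s, by simp [hst.symm], rfl⟩,
            block_subset_of_subset_union subset_rfl hsi hs⟩
        · exact ⟨_, Or.inr ⟨s, t, hst, rfl⟩, Finset.union_subset
            (block_subset_of_subset_union subset_rfl hsi hs)
            (block_subset_of_subset_union subset_rfl hti ht)⟩
  · rintro ⟨e, ⟨t, ht, rfl⟩ | he', he⟩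
    · rcases Finset.mem_union.1 (Finset.mem_coe.1 ht) with ht | ht
      · exact ⟨_, Or.inl ⟨t, ht, rfl⟩, he.trans Finset.subset_union_right⟩
      · exact ⟨_, Or.inr ⟨i, t, by simpa using ht, rfl⟩, Finset.union_subset_union subset_rfl he⟩
    · exact ⟨e, Or.inr he', he.trans Finset.subset_union_right⟩

/-- If all blocks but one are killed, monomials in the remaining block are regular. -/
lemma mk_prod_regular {S : Finset V} {T : Finset ι} {l : ι} (hl : l ∉ T)
    (hST : ∀ j, j ≠ l → j ∈ T ∨ ∃ v ∈ S, b v = j) {c : Finset V} (hc : c ⊆ block b l)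
    (hcS : Disjoint c S) (r : HypergraphAlgebra k (blockEdges G b)) :
    Ideal.Quotient.mk (edgeIdeal k (blockEdges G b)) (∏ w ∈ c, MvPolynomial.X w) * r ∈
        monomialIdeal k (blockEdges G b) (mixedSets b S T) ↔
      r ∈ monomialIdeal k (blockEdges G b) (mixedSets b S T) := by
  refine mk_prod_mul_mem_monomialIdeal_iff (fun Z => ⟨?_, ?_⟩) r
  · have key (j : ι) (hj : j ≠ l) (h : block b j ⊆ Z) :
        ∃ e ∈ mixedSets b S T ∪ blockEdges G b, e ⊆ Z := by
      rcases hST j hj with hj' | ⟨v, hv, rfl⟩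
      · exact ⟨_, Or.inl (Or.inr ⟨j, hj', rfl⟩), h⟩
      · exact ⟨_, Or.inl (Or.inl ⟨v, hv, rfl⟩), by simpa using h (by simp)⟩
    rintro ⟨e, (⟨v, hv, rfl⟩ | ⟨j, hj, rfl⟩) | ⟨s, t, hst, rfl⟩, he⟩
    · refine ⟨_, Or.inl (Or.inl ⟨v, hv, rfl⟩), ?_⟩
      have hvc : v ∉ c := fun h => Finset.disjoint_left.1 hcS h hv
      simpa [hvc] using he
    · have hjl : j ≠ l := by rintro rfl; exact hl hj
      exact key j hjl (block_subset_of_subset_union hc hjl he)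
    -- An edge of $G$ has an endpoint other than $l$, and the block there is killed already; so the
    -- edges impose no condition on block $l$.
    · by_cases hsl : s = l
      · have htl : t ≠ l := by rintro rfl; exact hst.ne hsl
        exact key t htl (block_subset_of_subset_union hc htl (Finset.union_subset_right he))
      · exact key s hsl (block_subset_of_subset_union hc hsl (Finset.union_subset_left he))
  · rintro ⟨e, he, h⟩
    exact ⟨e, he, h.trans Finset.subset_union_right⟩

lemma insert_singleton_mixedSets (S : Finset V) (T : Finset ι) (v : V) :
    insert {v} (mixedSets b S T) = mixedSets b (insert v S) T := by
  rw [mixedSets, mixedSets, Finset.coe_insert, Set.image_insert_eq, Set.insert_union]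

lemma empty_notMem_blockEdges (hb : Function.Surjective b) : ∅ ∉ blockEdges G b := by
  rintro ⟨i, j, -, h⟩
  obtain ⟨v, hv⟩ := block_nonempty hb i
  have : v ∈ block b i ∪ block b j := Finset.mem_union_left _ hv
  rw [← h] at this
  simp at this

/-- Killing some variables of a block, when all other blocks are killed. -/
lemma hasTorSeries_kill_variables {S : Finset V} {T : Finset ι} {l : ι} (hl : l ∉ T)
    (hST : ∀ j, j ≠ l → j ∈ T ∨ ∃ v ∈ S, b v = j) (hS : ∀ v ∈ S, b v ≠ l) {p : PowerSeries ℤ}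
    (hp : HasTorSeries k (residueModule k (blockEdges G b))
      (HypergraphAlgebra k (blockEdges G b) ⧸
        monomialIdeal k (blockEdges G b) (mixedSets b S T)) p)
    (B : Finset V) (hB : B ⊆ block b l) :
    HasTorSeries k (residueModule k (blockEdges G b))
      (HypergraphAlgebra k (blockEdges G b) ⧸
        monomialIdeal k (blockEdges G b) (mixedSets b (S ∪ B) T)) ((1 + X) ^ B.card * p) := by
  induction B using Finset.induction_on with
  | empty =>
    rw [Finset.union_empty]
    simpa using hp
  | insert v B hv ih =>
    have hvl := hB (Finset.mem_insert_self v B)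
    rw [Finset.card_insert_of_notMem hv, pow_succ', mul_assoc]
    refine HasTorSeries.quotient_sup_span _ (x := Ideal.Quotient.mk _ (∏ w ∈ {v}, MvPolynomial.X w))
      (mk_prod_smul_residueModule _ (by simp)) (mk_prod_regular k G hl ?_ (c := {v}) ?_ ?_) ?_
      (ih ((Finset.subset_insert v B).trans hB))
    · exact fun j hj => (hST j hj).imp id
        fun ⟨w, hw, hw'⟩ => ⟨w, Finset.mem_union_left _ hw, hw'⟩
    · simpa using hvl
    · rw [Finset.disjoint_singleton_left, Finset.mem_union]
      exact fun h => h.elim (fun h => hS v h (mem_block.1 hvl)) hv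
    · rw [monomialIdeal_sup_span, insert_singleton_mixedSets, Finset.union_insert]

variable [Fintype ι]

/-- The Poincaré series of the module where the blocks in `D` are killed variable by variable and
the other blocks only by the product of their variables. -/
lemma hasTorSeries_mixedSets (hb : Function.Surjective b) (D : Finset ι) :
    HasTorSeries k (residueModule k (blockEdges G b))
      (HypergraphAlgebra k (blockEdges G b) ⧸
        monomialIdeal k (blockEdges G b)
          (mixedSets b (Finset.univ.filter fun v => b v ∈ D) Dᶜ))
      ((1 + X) ^ (∑ i ∈ D, ((block b i).card - 1)) * indepInv G Finset.univ) := by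
  classical
  induction D using Finset.induction_on with
  | empty =>
    -- For $T=\iota$ the solution is $I(\emptyset)/I(G)=1/I(G)$.
    have h := hasTorSeries_quotient_genIdeal (residueModule k (blockEdges G b))
      (hasColonIdeals_blockMonomial k G)
      (fun i => mk_prod_smul_residueModule _ (block_nonempty hb i))
      (hasDim_residueModule (empty_notMem_blockEdges G hb))
      (fun T => indepSum G indepWeight Tᶜ * indepInv G Finset.univ)
      (by simp [indepSum_mul_indepInv])
      (fun T i hi => by rw [indepSum_compl_insert G hi]; ring) Finset.univ
    rw [genIdeal_blockMonomial] at h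
    have h0 : mixedSets b (Finset.univ.filter fun v => b v ∈ (∅ : Finset ι)) ∅ᶜ =
        block b '' (Finset.univ : Finset ι) := by
      simp [mixedSets]
    rw [h0]
    simpa [indepSum_empty] using h
  | insert l D hl ih =>
    set S := Finset.univ.filter fun v => b v ∈ D with hS
    set T := (insert l D)ᶜ with hT
    have hlT : l ∉ T := by simp [hT]
    have hSl : ∀ v ∈ S, b v ≠ l := by
      rintro v hv rfl
      exact hl (by simpa [hS] using hv)
    have hDT : Dᶜ = insert l T := by
      ext j
      by_cases hj : j = l <;> simp [hT, hj, hl]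
    have hST : ∀ j, j ≠ l → j ∈ T ∨ ∃ v ∈ S, b v = j := by
      intro j hj
      by_cases hjD : j ∈ D
      · obtain ⟨v, rfl⟩ := hb j
        exact Or.inr ⟨v, by simpa [hS] using hjD, rfl⟩
      · exact Or.inl (by simp [hT, hj, hjD])
    have hSB : Finset.univ.filter (fun v => b v ∈ insert l D) = S ∪ block b l := by
      ext v
      simp [hS, or_comm]
    obtain ⟨m, hm⟩ := Nat.exists_eq_succ_of_ne_zero (block_nonempty hb l).card_ne_zero
    set p := (1 + X) ^ (∑ i ∈ D, ((block b i).card - 1)) * indepInv G Finset.univ with hp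
    -- Drop the generator $y_l$, leaving block $l$ untouched: $y_l$ is regular on the resulting
    -- quotient, which costs a factor $1/(1+X)$.
    have hq : HasTorSeries k (residueModule k (blockEdges G b))
        (HypergraphAlgebra k (blockEdges G b) ⧸
          monomialIdeal k (blockEdges G b) (mixedSets b S T)) (invOneAddX * p) := by
      refine HasTorSeries.of_quotient_sup_span _
        (x := Ideal.Quotient.mk _ (∏ w ∈ block b l, MvPolynomial.X w))
        (mk_prod_smul_residueModule _ (block_nonempty hb l))
        (mk_prod_regular k G hlT hST subset_rfl ?_)
        (J' := monomialIdeal k (blockEdges G b) (mixedSets b S Dᶜ)) ?_ ?_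
      · exact Finset.disjoint_left.2 fun v hv hv' => hSl v hv' (mem_block.1 hv)
      · rw [monomialIdeal_sup_span, insert_block_mixedSets, hDT]
      · rw [← mul_assoc, one_add_X_mul_invOneAddX, one_mul]
        exact ih
    have h := hasTorSeries_kill_variables k G hlT hST hSl hq (block b l) subset_rfl
    rw [hSB, Finset.sum_insert hl]
    convert h using 1
    rw [hm, Nat.succ_sub_one, pow_succ, pow_add]
    linear_combination (-(1 + X) ^ m * p) * one_add_X_mul_invOneAddX

/-- The Poincaré series of the hypergraph algebra of a blown-up graph. -/
theorem finite_and_poincareSeries_blockEdges (hb : Function.Surjective b) :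
    (∀ i, Module.Finite k (hypergraphTor k (blockEdges G b) i)) ∧
      poincareSeries k (blockEdges G b) =
        (1 + X) ^ (Fintype.card V - Fintype.card ι) * indepInv G Finset.univ := by
  have h := hasTorSeries_mixedSets k G hb Finset.univ
  -- With every block in $D$, all variables are killed and the module is the residue module.
  have hirr : monomialIdeal k (blockEdges G b)
      (mixedSets b (Finset.univ.filter fun v => b v ∈ (Finset.univ : Finset ι)) Finset.univᶜ) =
      irrelevantIdeal k (blockEdges G b) := by
    rw [irrelevantIdeal_eq]
    simp [mixedSets]
  rw [hirr, sum_card_block hb] at h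
  have h' (n : ℕ) : HasDim k (((Tor (ModuleCat.{max u v} (HypergraphAlgebra k (blockEdges G b)))
      n).obj (residueModule k (blockEdges G b))).obj (residueModule k (blockEdges G b))) _ :=
    (h n).of_iso (torIsoTorModule _ n (residueModule k (blockEdges G b))).symm
  refine ⟨fun n => (h' n).1, ?_⟩
  ext n
  rw [poincareSeries, coeff_mk]
  exact (h' n).2

end Blocks

/-! ### Independence polynomials of paths and cycles. -/

section Graphs

open PowerSeries

/-- The infinite path `0 - 1 - 2 - ⋯`. -/
def natPath : SimpleGraph ℕ := SimpleGraph.fromRel fun i j => i + 1 = j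

/-- The path with `n` edges on `Fin (n + 1)`. -/
def lineGraph (n : ℕ) : SimpleGraph (Fin (n + 1)) := SimpleGraph.fromRel fun i j => (i : ℕ) + 1 = j

/-- The cycle on `Fin n`. -/
def rotateGraph (n : ℕ) : SimpleGraph (Fin n) := SimpleGraph.fromRel fun i j => finRotate n i = j

lemma natPath_adj {i j : ℕ} : natPath.Adj i j ↔ i + 1 = j ∨ j + 1 = i := by
  simp only [natPath, SimpleGraph.fromRel_adj]
  omega

lemma lineGraph_adj {n : ℕ} {i j : Fin (n + 1)} :
    (lineGraph n).Adj i j ↔ (i : ℕ) + 1 = j ∨ (j : ℕ) + 1 = i := by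
  simp only [lineGraph, SimpleGraph.fromRel_adj, ne_eq, Fin.ext_iff]
  omega

/-- The independence series of the path with `n` vertices. -/
def pathSum (n : ℕ) : PowerSeries ℤ := indepSum natPath indepWeight (Finset.range n)

lemma pathSum_add_two (n : ℕ) : pathSum (n + 2) = pathSum (n + 1) + indepWeight * pathSum n := by
  classical
  have h : (Finset.range (n + 1)).filter (fun j => ¬ natPath.Adj (n + 1) j) = Finset.range n := by
    ext j
    simp only [Finset.mem_filter, Finset.mem_range, natPath_adj]
    omega
  rw [pathSum, Finset.range_add_one, indepSum_insert _ _ (by simp), h]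
  rfl

lemma indepSum_lineGraph (n : ℕ) :
    indepSum (lineGraph n) indepWeight Finset.univ = pathSum (n + 1) := by
  rw [pathSum, ← Nat.Iio_eq_range, ← Fin.map_valEmbedding_univ, indepSum_map]
  intro i _ j _
  simp [natPath_adj, lineGraph_adj]

lemma val_finRotate {n : ℕ} (i : Fin n) :
    (finRotate n i : ℕ) = if (i : ℕ) + 1 = n then 0 else (i : ℕ) + 1 := by
  cases n with
  | zero => exact i.elim0
  | succ m =>
    rw [coe_finRotate]
    simp [Fin.ext_iff]

lemma rotateGraph_adj {n : ℕ} (hn : 2 ≤ n) {i j : Fin n} :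
    (rotateGraph n).Adj i j ↔ finRotate n i = j ∨ finRotate n j = i := by
  rw [rotateGraph, SimpleGraph.fromRel_adj]
  refine and_iff_right_of_imp fun h => ?_
  rintro rfl
  have := congrArg Fin.val (or_self_iff.1 h)
  rw [val_finRotate] at this
  split_ifs at this <;> omega

/-- Deleting the last vertex of the cycle leaves a path on $m+1$ vertices; deleting its two
neighbours as well leaves one on $m-1$. -/
lemma indepSum_rotateGraph (m : ℕ) (hm : 2 ≤ m) :
    indepSum (rotateGraph (m + 2)) indepWeight Finset.univ =
      pathSum (m + 1) + indepWeight * pathSum (m - 1) := by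
  classical
  have hadj (i j : Fin (m + 2)) : (rotateGraph (m + 2)).Adj i j ↔
      ((i : ℕ) + 1 = j ∨ (j : ℕ) + 1 = i) ∨ ((i : ℕ) = m + 1 ∧ (j : ℕ) = 0) ∨
        ((j : ℕ) = m + 1 ∧ (i : ℕ) = 0) := by
    rw [rotateGraph_adj (by omega), Fin.ext_iff, Fin.ext_iff, val_finRotate, val_finRotate]
    split_ifs <;> omega
  have h1 : (Finset.univ : Finset (Fin (m + 2))) =
      insert (Fin.last (m + 1)) (Finset.univ.map Fin.castSuccEmb) := by
    rw [Fin.univ_castSuccEmb, Finset.cons_eq_insert]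
  have h2 : (Finset.univ.map Fin.castSuccEmb).filter
      (fun j => ¬ (rotateGraph (m + 2)).Adj (Fin.last (m + 1)) j) =
      (Finset.univ : Finset (Fin (m - 1))).map
        (⟨fun j => ⟨j + 1, by omega⟩, fun a b h =>
          Fin.ext (Nat.succ_injective (congrArg Fin.val h))⟩ :
          Fin (m - 1) ↪ Fin (m + 2)) := by
    ext j
    simp only [Finset.mem_filter, Finset.mem_map, Finset.mem_univ, true_and, hadj, Fin.val_last,
      Fin.ext_iff, Fin.castSuccEmb_apply, Fin.val_castSucc]
    constructor
    · rintro ⟨⟨a, ha⟩, h⟩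
      exact ⟨⟨j - 1, by omega⟩, show (j : ℕ) - 1 + 1 = j by omega⟩
    · rintro ⟨a, ha⟩
      have ha' : (a : ℕ) + 1 = j := ha
      exact ⟨⟨⟨j, by omega⟩, rfl⟩, by omega⟩
  obtain ⟨l, rfl⟩ : ∃ l, m = l + 2 := ⟨m - 2, by omega⟩
  rw [h1, indepSum_insert _ _ (by simp [Fin.ext_iff]; omega), h2,
    indepSum_map (G := lineGraph (l + 2)), indepSum_map (G := lineGraph l), indepSum_lineGraph,
    indepSum_lineGraph]
  · rfl
  · intro i _ j _
    rw [hadj, lineGraph_adj]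
    simp
  · intro i _ j _
    rw [hadj, lineGraph_adj]
    simp
    omega

end Graphs

/-! ### Hyperlines and hypercycles with $d=2\alpha$ are blow-ups. -/

section Hypergraphs

lemma eq_union_of_subset {V : Type*} [DecidableEq V] {α : ℕ} {s t r : Finset V} (hs : s ⊆ r) (ht : t ⊆ r)
    (hst : Disjoint s t) (hsc : s.card = α) (htc : t.card = α) (hr : r.card = 2 * α) :
    r = s ∪ t := by
  refine (Finset.eq_of_subset_of_card_le (Finset.union_subset hs ht) ?_).symm
  rw [Finset.card_union_of_disjoint hst]
  omega

variable {V : Type v} [Fintype V] [DecidableEq V]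

lemma range_eq_blockEdges_lineGraph {n : ℕ} {e : Fin n → Finset V} {b : V → Fin (n + 1)}
    (he : ∀ i, e i = block b i.castSucc ∪ block b i.succ) :
    Set.range e = blockEdges (lineGraph n) b := by
  ext s
  constructor
  · rintro ⟨i, rfl⟩
    exact ⟨_, _, lineGraph_adj.2 (Or.inl (by simp)), he i⟩
  · rintro ⟨i, j, hij, rfl⟩
    rcases lineGraph_adj.1 hij with h | h
    · refine ⟨⟨i, by omega⟩, ?_⟩
      rw [he]
      congr 2
      exact Fin.ext (by simpa using h)
    · refine ⟨⟨j, by omega⟩, ?_⟩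
      rw [he, Finset.union_comm]
      congr 2
      exact Fin.ext (by simpa using h)

lemma range_eq_blockEdges_rotateGraph {n : ℕ} (hn : 2 ≤ n) {e : Fin n → Finset V} {b : V → Fin n}
    (he : ∀ i, e i = block b i ∪ block b (finRotate n i)) :
    Set.range e = blockEdges (rotateGraph n) b := by
  ext s
  constructor
  · rintro ⟨i, rfl⟩
    exact ⟨_, _, (rotateGraph_adj hn).2 (Or.inl rfl), he i⟩
  · rintro ⟨i, j, hij, rfl⟩
    rcases (rotateGraph_adj hn).1 hij with rfl | rfl
    · exact ⟨i, he i⟩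
    · exact ⟨j, (he j).trans (Finset.union_comm _ _)⟩

/-- Pairwise disjoint sets whose sizes add up to the number of points are the fibres of a map. -/
lemma exists_block_eq {ι : Type*} [Fintype ι] [DecidableEq ι] {α : ℕ} (hα : 1 ≤ α)
    (A : ι → Finset V) (hcard : ∀ i, (A i).card = α)
    (hdisj : ∀ i j, i ≠ j → Disjoint (A i) (A j)) (hV : Fintype.card V = Fintype.card ι * α) :
    ∃ b : V → ι, Function.Surjective b ∧ ∀ i, block b i = A i := by
  have hU : Finset.univ.biUnion A = Finset.univ := by
    refine Finset.eq_univ_of_card _ ?_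
    rw [Finset.card_biUnion fun i _ j _ hij => hdisj i j hij, hV]
    simp [hcard]
  have hex (v : V) : ∃ i, v ∈ A i := by
    have := Finset.mem_univ v
    rw [← hU] at this
    simpa using this
  choose b hb using hex
  have hblock (i : ι) : block b i = A i := by
    ext v
    rw [mem_block]
    refine ⟨fun h => h ▸ hb v, fun h => ?_⟩
    by_contra hne
    exact Finset.disjoint_left.1 (hdisj _ _ hne) (hb v) h
  refine ⟨b, fun i => ?_, hblock⟩
  obtain ⟨v, hv⟩ := Finset.card_pos.1 ((hcard i).symm ▸ hα : 0 < (A i).card)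
  exact ⟨v, mem_block.1 ((hblock i).symm ▸ hv)⟩

/-- The blocks are the overlaps of consecutive edges together with the two free halves at the ends.
-/
lemma IsHyperline.exists_sets {n α : ℕ} {e : Fin n → Finset V} (he : IsHyperline (2 * α) α e) :
    ∃ A : Fin (n + 1) → Finset V, (∀ i, (A i).card = α) ∧
      (∀ i j, i ≠ j → Disjoint (A i) (A j)) ∧ ∀ i, A i.castSucc ⊆ e i ∧ A i.succ ⊆ e i := by
  match n, e, he with
  | 0, e, he =>
    refine ⟨fun _ => Finset.univ, fun _ => ?_, fun i j hij => absurd (Fin.ext (by omega)) hij,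
      fun i => i.elim0⟩
    have := he.card_vertices
    push_cast at this
    rw [Finset.card_univ]
    zify
    linarith
  -- A single edge has no overlap that would single out its halves, so it is split arbitrarily.
  | 1, e, he =>
    obtain ⟨t, ht, htc⟩ := Finset.exists_subset_card_eq (s := e 0) (n := α)
      (by rw [he.card_edge]; omega)
    have hd : Disjoint t (e 0 \ t) := Finset.disjoint_sdiff
    refine ⟨![t, e 0 \ t], ?_, ?_, ?_⟩
    · have : (e 0 \ t).card = α := by
        rw [Finset.card_sdiff_of_subset ht, he.card_edge, htc]; omega
      simp [Fin.forall_fin_two, htc, this]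
    · simp [Fin.forall_fin_two, hd, hd.symm]
    · intro i
      obtain rfl := Subsingleton.elim i 0
      exact ⟨ht, Finset.sdiff_subset⟩
  | n + 2, e, he =>
    -- Block $j$ collects the vertices lying in exactly the edges $j-1$ and $j$, as far as these
    -- exist; this covers both ends uniformly.
    let A : Fin (n + 3) → Finset V := fun j =>
      Finset.univ.filter fun v => ∀ i : Fin (n + 2), v ∈ e i ↔ ((i : ℕ) = j ∨ (i : ℕ) + 1 = j)
    have hmem (j : Fin (n + 3)) (v : V) : v ∈ A j ↔
        ∀ i : Fin (n + 2), v ∈ e i ↔ ((i : ℕ) = j ∨ (i : ℕ) + 1 = j) := by simp [A]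
    have hfar (i j : Fin (n + 2)) (v : V) (hi : v ∈ e i) (hj : v ∈ e j) :
        (i : ℕ) = j ∨ (i : ℕ) + 1 = j ∨ (j : ℕ) + 1 = i := by
      by_contra hc
      have := he.inter_eq_empty i j (by rintro rfl; omega) (by
        intro h
        rcases (abs_eq zero_le_one).1 h with h | h <;> omega)
      exact Finset.notMem_empty v (this ▸ Finset.mem_inter.2 ⟨hi, hj⟩)
    have hnear (i j : Fin (n + 2)) (h : (i : ℕ) + 1 = j) : (e i ∩ e j).card = α :=
      he.card_inter i j (by rw [abs_eq zero_le_one]; omega)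
    refine ⟨A, fun j => ?_, fun j j' hjj => ?_, fun i => ⟨fun v hv => ?_, fun v hv => ?_⟩⟩
    · by_cases h0 : (j : ℕ) = 0
      · have hA : A j = e ⟨0, by omega⟩ \ e ⟨1, by omega⟩ := by
          ext v
          rw [hmem, Finset.mem_sdiff]
          refine ⟨fun h => ⟨(h _).2 (by simp [h0]), fun h' => by simpa [h0] using (h _).1 h'⟩,
            fun ⟨h1, h2⟩ i => ⟨fun hi => ?_, fun hi => ?_⟩⟩
          · have := hfar i _ v hi h1
            have h3 : (i : ℕ) ≠ 1 := fun h => h2 (by convert hi; exact h.symm)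
            simp only at this
            omega
          · convert h1
            omega
        rw [hA, Finset.card_sdiff, Finset.inter_comm, hnear _ _ rfl, he.card_edge]
        omega
      · by_cases hl : (j : ℕ) = n + 2
        · have hA : A j = e ⟨n + 1, by omega⟩ \ e ⟨n, by omega⟩ := by
            ext v
            rw [hmem, Finset.mem_sdiff]
            refine ⟨fun h => ⟨(h _).2 (by simp [hl]), fun h' => by simpa [hl] using (h _).1 h'⟩,
              fun ⟨h1, h2⟩ i => ⟨fun hi => ?_, fun hi => ?_⟩⟩
            · have := hfar i _ v hi h1
              have h3 : (i : ℕ) ≠ n := fun h => h2 (by convert hi; exact h.symm)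
              simp only at this
              omega
            · convert h1
              omega
          rw [hA, Finset.card_sdiff, hnear _ _ rfl, he.card_edge]
          omega
        · have hA : A j = e ⟨j - 1, by omega⟩ ∩ e ⟨j, by omega⟩ := by
            ext v
            rw [hmem, Finset.mem_inter]
            refine ⟨fun h => ⟨(h _).2 (by simp; omega), (h _).2 (by simp)⟩,
              fun ⟨h1, h2⟩ i => ⟨fun hi => ?_, fun hi => ?_⟩⟩
            · have := hfar i _ v hi h1
              have := hfar i _ v hi h2
              simp only at *
              omega
            · rcases hi with hi | hi
              · convert h2
              · convert h1
                omega
          rw [hA, hnear _ _ (by simp; omega)]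
    · rw [Finset.disjoint_left]
      intro v hv hv'
      rw [hmem] at hv hv'
      have h (i : Fin (n + 2)) := (hv i).symm.trans (hv' i)
      have hjj' : (j : ℕ) ≠ j' := fun h => hjj (Fin.ext h)
      -- With at least two edges, different positions have different sets of incident edges, and one
      -- of the four indices below witnesses this.
      have key (a : ℕ) (ha : a < n + 2) := h ⟨a, ha⟩
      simp only at key
      have k1 := key (j - 1)
      have k2 := key j
      have k3 := key (j' - 1)
      have k4 := key j'
      omega
    · exact ((hmem _ v).1 hv i).2 (by simp)
    · exact ((hmem _ v).1 hv i).2 (by simp)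

lemma IsHyperline.exists_block {n α : ℕ} (hα : 1 ≤ α) {e : Fin n → Finset V}
    (he : IsHyperline (2 * α) α e) : Fintype.card V = (n + 1) * α ∧
      ∃ b : V → Fin (n + 1), Function.Surjective b ∧
        ∀ i, e i = block b i.castSucc ∪ block b i.succ := by
  have hV : Fintype.card V = (n + 1) * α := by
    have := he.card_vertices
    push_cast at this
    zify
    linarith
  obtain ⟨A, hA, hd, hs⟩ := he.exists_sets
  obtain ⟨b, hb, hbA⟩ := exists_block_eq hα A hA hd (by rw [hV, Fintype.card_fin])
  refine ⟨hV, b, hb, fun i => ?_⟩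
  rw [hbA, hbA]
  exact eq_union_of_subset (hs i).1 (hs i).2 (hd _ _ (Fin.castSucc_lt_succ).ne) (hA _) (hA _)
    (he.card_edge i)

lemma cyclicallyAdjacent_iff {n : ℕ} {i j : Fin n} :
    CyclicallyAdjacent i j ↔ finRotate n i = j ∨ finRotate n j = i := by
  have key (i j : Fin n) : (i : ℤ) - j ≡ 1 [ZMOD n] ↔ finRotate n j = i := by
    rw [Int.modEq_iff_dvd, Fin.ext_iff, val_finRotate]
    have hi := i.2
    have hj := j.2
    constructor
    · rintro ⟨c, hc⟩
      -- Here $nc=1-(i-j)$ lies between $2-n$ and $n$, so $c\in\{0,1\}$; $c=1$ is the wrap-around.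
      have h1 : c < 2 := by
        by_contra! h
        nlinarith
      have h2 : -1 < c := by
        by_contra! h
        nlinarith
      interval_cases c <;> split_ifs <;> omega
    · intro h
      split_ifs at h with h'
      · exact ⟨1, by omega⟩
      · exact ⟨0, by omega⟩
  rw [CyclicallyAdjacent, key, key, or_comm]

/-- The blocks are the overlaps of consecutive edges. They are disjoint once no vertex lies in three
consecutive edges, and then counting shows that they fill $V$. -/
lemma IsHypercycle.exists_block {n α : ℕ} (hn : 3 ≤ n) (hα : 1 ≤ α) {e : Fin n → Finset V}
    (he : IsHypercycle (2 * α) α e) : Fintype.card V = n * α ∧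
      ∃ b : V → Fin n, Function.Surjective b ∧
        ∀ i, e i = block b i ∪ block b (finRotate n i) := by
  have hV : Fintype.card V = n * α := by
    have := he.card_vertices
    push_cast at this
    zify
    linarith
  set σ := finRotate n with hσ
  have hne (i : Fin n) : i ≠ σ i := by
    rw [ne_eq, Fin.ext_iff, val_finRotate]
    split_ifs <;> omega
  have hcard (i : Fin n) : (e i ∩ e (σ i)).card = α :=
    he.card_inter i _ (hne i) (cyclicallyAdjacent_iff.2 (Or.inl rfl))
  have hfar (i j : Fin n) (v : V) (hi : v ∈ e i) (hj : v ∈ e j) : i = j ∨ σ i = j ∨ σ j = i := by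
    by_contra! hc
    have := he.inter_eq_empty i j hc.1 (by rw [cyclicallyAdjacent_iff]; tauto)
    exact Finset.notMem_empty v (this ▸ Finset.mem_inter.2 ⟨hi, hj⟩)
  have htriple (i : Fin n) (v : V) (h1 : v ∈ e i) (h2 : v ∈ e (σ i)) (h3 : v ∈ e (σ (σ i))) :
      False := by
    by_cases hn4 : 4 ≤ n
    · have := hfar _ _ v h1 h3
      have hval (j : Fin n) : (σ j : ℕ) = if (j : ℕ) + 1 = n then 0 else (j : ℕ) + 1 :=
        val_finRotate j
      simp only [Fin.ext_iff] at this
      have k1 := hval i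
      have k2 := hval (σ i)
      -- For $n\ge4$ the edges $i$ and $i+2$ are distinct and not cyclically adjacent, contradicting
      -- `hfar`.
      have k3 := hval (σ (σ i))
      split_ifs at k1 k2 k3 <;> omega
    · obtain rfl : n = 3 := by omega
      have hσ3 : σ (σ (σ i)) = i := by
        rw [Fin.ext_iff, val_finRotate, val_finRotate, val_finRotate]
        split_ifs <;> omega
      -- For $n=3$ all edges are adjacent and one counts: two edges cover
      -- $4\alpha-\alpha=3\alpha=|V|$ vertices. So the third edge, of size $2\alpha$, is the union
      -- of its two overlaps of size $\alpha$, which must be disjoint.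
      have hU : e i ∪ e (σ i) = Finset.univ := by
        refine Finset.eq_univ_of_card _ ?_
        have := Finset.card_union_add_card_inter (e i) (e (σ i))
        rw [hcard, he.card_edge, he.card_edge] at this
        omega
      have h4 : (e (σ (σ i)) ∩ e i) ∪ (e (σ i) ∩ e (σ (σ i))) = e (σ (σ i)) := by
        rw [Finset.inter_comm (e (σ i)), ← Finset.inter_union_distrib_left, hU, Finset.inter_univ]
      have h5 := Finset.card_union_add_card_inter (e (σ (σ i)) ∩ e i) (e (σ i) ∩ e (σ (σ i)))
      have h6 := hcard (σ (σ i))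
      rw [hσ3] at h6
      rw [h4, hcard, h6, he.card_edge] at h5
      have h7 : (e (σ (σ i)) ∩ e i ∩ (e (σ i) ∩ e (σ (σ i)))) = ∅ :=
        Finset.card_eq_zero.1 (by omega)
      refine Finset.notMem_empty v (h7 ▸ ?_)
      simp [h1, h2, h3]
  have hd' (i j : Fin n) (hij : i ≠ j) : Disjoint (e i ∩ e (σ i)) (e j ∩ e (σ j)) := by
    rw [Finset.disjoint_left]
    intro v hv hv'
    rw [Finset.mem_inter] at hv hv'
    rcases hfar i j v hv.1 hv'.1 with h | h | h
    · exact hij h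
    · exact htriple i v hv.1 hv.2 (by rw [h]; exact hv'.2)
    · exact htriple j v hv'.1 hv'.2 (by rw [h]; exact hv.2)
  let A : Fin n → Finset V := fun j => e (σ.symm j) ∩ e j
  have hA (j : Fin n) : (A j).card = α := by
    have := hcard (σ.symm j)
    rwa [σ.apply_symm_apply] at this
  have hd (i j : Fin n) (hij : i ≠ j) : Disjoint (A i) (A j) := by
    have := hd' (σ.symm i) (σ.symm j) (fun h => hij (σ.symm.injective h))
    rwa [σ.apply_symm_apply, σ.apply_symm_apply] at this
  obtain ⟨b, hb, hbA⟩ := exists_block_eq hα A hA hd (by rw [hV, Fintype.card_fin])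
  refine ⟨hV, b, hb, fun i => ?_⟩
  rw [hbA, hbA]
  refine eq_union_of_subset Finset.inter_subset_right ?_ (hd _ _ (hne i)) (hA _) (hA _)
    (he.card_edge i)
  simp only [A, σ.symm_apply_apply]
  exact Finset.inter_subset_left

end Hypergraphs

/-! ### Translation into the series of $L_n$ and $C_n$. -/

section Series

open PowerSeries

variable (k : Type u) [Field k]

lemma mul_tsub_self (m α : ℕ) : m * α - m = m * (α - 1) := by
  rw [Nat.mul_sub, mul_one]

lemma block_id {ι : Type*} [Fintype ι] [DecidableEq ι] (i : ι) : block (id : ι → ι) i = {i} := by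
  ext j
  simp

lemma range_lineEdge (n : ℕ) : Set.range (lineEdge n) = blockEdges (lineGraph n) id :=
  range_eq_blockEdges_lineGraph fun i => by simp only [block_id]; rfl

lemma range_cycleEdge {n : ℕ} (hn : 2 ≤ n) :
    Set.range (cycleEdge n) = blockEdges (rotateGraph n) id :=
  range_eq_blockEdges_rotateGraph hn fun i => by simp only [block_id]; rfl

lemma lineSeries_eq (n : ℕ) : lineSeries k n = indepInv (lineGraph n) Finset.univ := by
  rw [lineSeries, range_lineEdge,
    (finite_and_poincareSeries_blockEdges k _ Function.surjective_id).2]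
  simp

lemma cycleSeries_eq {n : ℕ} (hn : 2 ≤ n) :
    cycleSeries k n = indepInv (rotateGraph n) Finset.univ := by
  rw [cycleSeries, range_cycleEdge hn,
    (finite_and_poincareSeries_blockEdges k _ Function.surjective_id).2]
  simp

lemma pathSum_mul_lineSeries (n : ℕ) : pathSum (n + 1) * lineSeries k n = 1 := by
  rw [lineSeries_eq, ← indepSum_lineGraph, indepSum_mul_indepInv]

lemma rotateSum_mul_cycleSeries {m : ℕ} (hm : 2 ≤ m) :
    (pathSum (m + 1) + indepWeight * pathSum (m - 1)) * cycleSeries k (m + 2) = 1 := by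
  rw [cycleSeries_eq k (by omega), ← indepSum_rotateGraph m hm, indepSum_mul_indepInv]

lemma constantCoeff_lineSeries (n : ℕ) : constantCoeff (lineSeries k n) = 1 := by
  have h := congrArg constantCoeff (pathSum_mul_lineSeries k n)
  rwa [map_mul, pathSum, constantCoeff_indepSum, one_mul, map_one] at h

lemma isUnit_denominator (m n : ℕ) :
    IsUnit ((1 + X) * lineSeries k m - X * lineSeries k n) := by
  rw [isUnit_iff_constantCoeff]
  simp [constantCoeff_lineSeries]

/-- If `1/P = 1/A + u/B` with `u = -X/(1+X)`, then `P ((1+X) B - X A) = (1+X) A B`. -/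
lemma mul_denominator_eq {a b P A B : PowerSeries ℤ} (hA : a * A = 1) (hB : b * B = 1)
    (hP : (a + indepWeight * b) * P = 1) :
    P * ((1 + X) * B - X * A) = (1 + X) * A * B := by
  have h : (1 + X) * B - X * A = (1 + X) * A * B * (a + indepWeight * b) := by
    linear_combination (-(1 + X) * B) * hA - (1 + X) * A * indepWeight * hB - A * indepWeight_mul
  rw [h]
  linear_combination (1 + X) * A * B * hP

end Series

end

/-- An identity `P = N / D` of formal power series is stated as `IsUnit D ∧ P * D = N`, and the
finiteness of all `dim_k Tor_i(k, k)` is part of the claim. -/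
theorem theorem1 (k : Type u) [Field k] :
    -- the Poincaré series of `L_n` and `C_n` are defined
    (∀ n i : ℕ, Module.Finite k (hypergraphTor k (Set.range (lineEdge n)) i)) ∧
    (∀ n i : ℕ, 3 ≤ n → Module.Finite k (hypergraphTor k (Set.range (cycleEdge n)) i)) ∧
    -- initial values
    lineSeries k 0 = 1 + PowerSeries.X ∧
    (IsUnit (1 - PowerSeries.X : PowerSeries ℤ) ∧
      lineSeries k 1 * (1 - PowerSeries.X) = 1 + PowerSeries.X) ∧
    -- recursion for `L_n`, `n ≥ 2`
    (∀ n : ℕ, 2 ≤ n →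
      IsUnit ((1 + PowerSeries.X) * lineSeries k (n - 2)
          - PowerSeries.X * lineSeries k (n - 1)) ∧
      lineSeries k n * ((1 + PowerSeries.X) * lineSeries k (n - 2)
          - PowerSeries.X * lineSeries k (n - 1))
        = (1 + PowerSeries.X) * lineSeries k (n - 1) * lineSeries k (n - 2)) ∧
    -- recursion for `C_n`, `n ≥ 4`
    (∀ n : ℕ, 4 ≤ n →
      IsUnit ((1 + PowerSeries.X) * lineSeries k (n - 4)
          - PowerSeries.X * lineSeries k (n - 2)) ∧
      cycleSeries k n * ((1 + PowerSeries.X) * lineSeries k (n - 4)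
          - PowerSeries.X * lineSeries k (n - 2))
        = (1 + PowerSeries.X) * lineSeries k (n - 2) * lineSeries k (n - 4)) ∧
    -- hyperlines with `d = 2α`
    (∀ (n α : ℕ), 1 ≤ α → ∀ (V : Type v) [Fintype V] [DecidableEq V] (e : Fin n → Finset V),
      IsHyperline (2 * α) α e →
        (∀ i : ℕ, Module.Finite k (hypergraphTor k (Set.range e) i)) ∧
        poincareSeries k (Set.range e)
          = (1 + PowerSeries.X) ^ ((n + 1) * (α - 1)) * lineSeries k n) ∧
    -- hypercycles with `d = 2α`
    (∀ (n α : ℕ), 3 ≤ n → 1 ≤ α →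
      ∀ (V : Type v) [Fintype V] [DecidableEq V] (e : Fin n → Finset V),
      IsHypercycle (2 * α) α e →
        (∀ i : ℕ, Module.Finite k (hypergraphTor k (Set.range e) i)) ∧
        poincareSeries k (Set.range e)
          = (1 + PowerSeries.X) ^ (n * (α - 1)) * cycleSeries k n) := by
  have hu := indepWeight_mul
  have h1 : pathSum 1 = 1 + indepWeight := by
    classical
    rw [pathSum, show Finset.range 1 = insert 0 ∅ from rfl,
      indepSum_insert _ _ (Finset.notMem_empty 0)]
    simp [indepSum_empty]
  have h0 : pathSum 0 = 1 := indepSum_empty _ _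
  have hL0 : lineSeries k 0 = 1 + PowerSeries.X := by
    have h := pathSum_mul_lineSeries k 0
    rw [zero_add, h1] at h
    linear_combination (1 + PowerSeries.X) * h - lineSeries k 0 * hu
  have hLfin (n i : ℕ) : Module.Finite k (hypergraphTor k (Set.range (lineEdge n)) i) := by
    rw [range_lineEdge]
    exact (finite_and_poincareSeries_blockEdges k _ Function.surjective_id).1 i
  have hCfin (n i : ℕ) (hn : 3 ≤ n) :
      Module.Finite k (hypergraphTor k (Set.range (cycleEdge n)) i) := by
    rw [range_cycleEdge (by omega)]
    exact (finite_and_poincareSeries_blockEdges k _ Function.surjective_id).1 i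
  refine ⟨hLfin, hCfin, hL0, ⟨?_, ?_⟩, fun n hn => ⟨isUnit_denominator k _ _, ?_⟩,
    fun n hn => ⟨isUnit_denominator k _ _, ?_⟩, fun n α hα V _ _ e he => ?_,
    fun n α hn hα V _ _ e he => ?_⟩
  · rw [PowerSeries.isUnit_iff_constantCoeff]
    simp
  · have h := pathSum_mul_lineSeries k 1
    rw [pathSum_add_two 0, zero_add, h1, h0] at h
    linear_combination (1 + PowerSeries.X) * h - 2 * lineSeries k 1 * hu
  · obtain ⟨m, rfl⟩ : ∃ m, n = m + 2 := ⟨n - 2, by omega⟩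
    refine mul_denominator_eq (pathSum_mul_lineSeries k (m + 1)) (pathSum_mul_lineSeries k m) ?_
    rw [← pathSum_add_two]
    exact pathSum_mul_lineSeries k (m + 2)
  · obtain ⟨m, rfl⟩ : ∃ m, n = m + 4 := ⟨n - 4, by omega⟩
    -- $L_j$ has $j+1$ vertices, so the paths on $n-1$ and $n-3$ vertices left in the $n$-cycle
    -- belong to $L_{n-2}$ and $L_{n-4}$.
    exact mul_denominator_eq (pathSum_mul_lineSeries k (m + 2)) (pathSum_mul_lineSeries k m)
      (rotateSum_mul_cycleSeries k (m := m + 2) (by omega))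
  · obtain ⟨hV, b, hb, heb⟩ := he.exists_block hα
    rw [range_eq_blockEdges_lineGraph heb]
    obtain ⟨hfin, hser⟩ := finite_and_poincareSeries_blockEdges k (lineGraph n) hb
    refine ⟨hfin, ?_⟩
    rw [hser, lineSeries_eq, hV, Fintype.card_fin, mul_tsub_self]
  · obtain ⟨hV, b, hb, heb⟩ := he.exists_block hn hα
    rw [range_eq_blockEdges_rotateGraph (by omega) heb]
    obtain ⟨hfin, hser⟩ := finite_and_poincareSeries_blockEdges k (rotateGraph n) hb
    refine ⟨hfin, ?_⟩
    rw [hser, cycleSeries_eq k (by omega), hV, Fintype.card_fin, mul_tsub_self]
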